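/- **Setting.** A *2-complex* is a connected (Hausdorff) CW complex of dimension at most $2$. An *immersion* $f:\mathcal C\to\mathcal D$ of CW complexes is a continuous map that carries each open $n$-cell bijectively onto an open $n$-cell and such that every point of $\mathcal C$ has a neighbourhood that $f$ maps homeomorphically onto its image. Every $1$-cell of a $2$-complex is regarded as a pair of oppositely directed edges. Let $X,P$ be sets and let $B_{X,P}$ be a $2$-complex with exactly one $0$-cell, whose $1$-cells (each with a chosen direction) are indexed by $X$ and whose $2$-cells are indexed by $P$; for every $\rho\in P$, with characteristic map $\Phi_\rho:D^2\to B_{X,P}$, a point $x_\rho\in\partial D^2$ with $\Phi_\rho(x_\rho)$ the $0$-cell is chosen. A *labeled 2-complex* over $B_{X,P}$ is a $2$-complex $\mathcal C$ with an immersion $g_{\mathcal C}:\mathcal C\to B_{X,P}$. It gives every directed edge $e$ of $\mathcal C$ a label $\ell(e)\in X\cup X^{-1}$ and every $2$-cell $c$ a label $\ell(c)\in P$, namely the index of the image. It also gives every $2$-cell $c$, with label $\rho$, a *root* $\alpha(c)$: the $0$-cell of $\mathcal C$ that is the limit, as $x\to x_\rho$ in the open disc, of the point of $c$ which $g_{\mathcal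 C}$ maps to $\Phi_\rho(x)$. Let $\mathcal C,\mathcal D$ be labeled $2$-complexes over the same $B_{X,P}$. An immersion $f:\mathcal C\to\mathcal D$ *respects the labeling* if $\ell(f(e))=\ell(e)$ for every directed edge $e$ and $\ell(f(c))=\ell(c)$ for every $2$-cell $c$ of $\mathcal C$, and the two labelings of $\mathcal C$ given by the immersions $g_{\mathcal D}\circ f$ and $g_{\mathcal C}$ determine the same root of every $2$-cell of $\mathcal C$. The labeled graph $\Gamma_{\mathcal C}$ has the $0$-cells of $\mathcal C$ as vertices; its edges are the directed edges of $\mathcal C$, with their labels in $X\cup X^{-1}$ and the reversal involution, together with, for each $2$-cell $c$, a loop $e_c$ at $\alpha(c)$ with label $\ell(c)\in P$, which is its own inverse. An immersion of labeled graphs that respects the labeling is a graph morphism (commuting with initial vertices, terminal vertices and inversion of edges) that preserves labels and is injective on the set of edges starting at each vertex. **Lemma.** Let $\mathcal C$ and $\mathcal D$ be labeled $2$-complexes over the same $B_{X,P}$. There is an immersion $\mathcal C\to\mathcal D$ that respects the labeling if and only if there is an immersion $\Gamma_{\mathcal C}\to\Gamma_{\mathcal D}$ that respects the labeling. -/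

import Mathlib

open Set Filter Topology Metric

namespace TwoComplexes

/-- The type of `n`-cells of a CW complex `C`. -/
abbrev Cell (C : Type*) [TopologicalSpace C] [CWComplex (univ : Set C)] (n : ℕ) :=
  RelCWComplex.cell (univ : Set C) n

/-- The characteristic map `Dⁿ → C` of an `n`-cell; as everywhere in Mathlib's CW complexes, `Dⁿ` is
the closed unit ball of `Fin n → ℝ` (for `n = 1`, the interval `[-1, 1]`). -/
noncomputable abbrev charMap {C : Type*} [TopologicalSpace C] [CWComplex (univ : Set C)] {n : ℕ}
    (c : Cell C n) : PartialEquiv (Fin n → ℝ) C :=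
  RelCWComplex.map n c

/-- The open cell as a subset of `C`. -/
abbrev openCell {C : Type*} [TopologicalSpace C] [CWComplex (univ : Set C)] {n : ℕ}
    (c : Cell C n) : Set C :=
  RelCWComplex.openCell n c

/-- The point of `C` that a `0`-cell consists of. -/
noncomputable abbrev point {C : Type*} [TopologicalSpace C] [CWComplex (univ : Set C)]
    (v : Cell C 0) : C :=
  charMap v 0

/-- A `2`-complex: a connected (Hausdorff) CW complex of dimension at most `2`. -/
class IsTwoComplex (C : Type*) [TopologicalSpace C] [CWComplex (univ : Set C)] : Prop
    extends T2Space C, ConnectedSpace C where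
  dim_le_two : ∀ n, 2 < n → IsEmpty (Cell C n)

/-- An immersion of CW complexes: a continuous map that carries each (open) `n`-cell bijectively
onto an (open) `n`-cell, and such that each point has a neighbourhood which is mapped
homeomorphically onto its image. -/
structure IsImmersion {C D : Type*} [TopologicalSpace C] [CWComplex (univ : Set C)]
    [TopologicalSpace D] [CWComplex (univ : Set D)] (f : C → D) : Prop where
  continuous : Continuous f
  exists_bijOn : ∀ (n : ℕ) (c : Cell C n), ∃ d : Cell D n, BijOn f (openCell c) (openCell d)
  exists_isEmbedding : ∀ y : C, ∃ U ∈ 𝓝 y, IsEmbedding (fun z : U => f z)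

section Cells

variable {C D : Type*} [TopologicalSpace C] [CWComplex (univ : Set C)]
  [TopologicalSpace D] [CWComplex (univ : Set D)]

/-- The `n`-cell `f(c)` onto which an immersion `f` maps the `n`-cell `c`. -/
noncomputable def IsImmersion.onCell {f : C → D} (hf : IsImmersion f) {n : ℕ} (c : Cell C n) :
    Cell D n :=
  (hf.exists_bijOn n c).choose

lemma IsImmersion.bijOn {f : C → D} (hf : IsImmersion f) {n : ℕ} (c : Cell C n) :
    BijOn f (openCell c) (openCell (hf.onCell c)) :=
  (hf.exists_bijOn n c).choose_spec

/-- A directed edge: a `1`-cell together with one of its two directions; `(e, true)` is `e`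
directed along its characteristic map `[-1, 1] → C`, and `(e, false)` is the reverse edge. -/
abbrev DirEdge (C : Type*) [TopologicalSpace C] [CWComplex (univ : Set C)] := Cell C 1 × Bool

/-- `f` maps the open `1`-cell `e` to the open `1`-cell `e'` in the direction-preserving way,
both directed along their characteristic maps. -/
def PreservesDirection (f : C → D) (e : Cell C 1) (e' : Cell D 1) : Prop :=
  StrictMonoOn (fun t : ℝ => (charMap e').symm (f (charMap e fun _ => t)) 0) (Ioo (-1) 1)

open Classical in
/-- The action of an immersion on directed edges. -/
noncomputable def IsImmersion.onDirEdge {f : C → D} (hf : IsImmersion f) (e : DirEdge C) :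
    DirEdge D :=
  (hf.onCell e.1, if PreservesDirection f e.1 (hf.onCell e.1) then e.2 else !e.2)

/-- The image of a point of the boundary sphere of a `1`-cell is a `0`-cell. -/
lemma exists_point_eq (e : Cell C 1) {s : Fin 1 → ℝ} (hs : s ∈ sphere (0 : Fin 1 → ℝ) 1) :
    ∃ v : Cell C 0, charMap e s = point v := by
  obtain ⟨x, y, h⟩ := CWComplex.exists_cellFrontier_one_eq (C := (univ : Set C)) e
  have h1 : charMap e s ∈ RelCWComplex.cellFrontier 1 e := mem_image_of_mem _ hs
  rw [h] at h1
  simp only [RelCWComplex.closedCell_zero_eq_singleton] at h1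
  rcases h1 with h1 | h1
  · exact ⟨x, by rw [mem_singleton_iff.1 h1, Subsingleton.elim (![] : Fin 0 → ℝ) 0]⟩
  · exact ⟨y, by rw [mem_singleton_iff.1 h1, Subsingleton.elim (![] : Fin 0 → ℝ) 0]⟩

/-- The initial vertex of a directed edge. -/
noncomputable def DirEdge.init (e : DirEdge C) : Cell C 0 :=
  (exists_point_eq e.1 (s := fun _ => if e.2 then -1 else 1)
    (by cases e.2 <;> simp [Pi.norm_def])).choose

/-- The reverse of a directed edge. -/
def DirEdge.rev (e : DirEdge C) : DirEdge C := (e.1, !e.2)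

/-- Let `g` map the open `2`-cell `c` of `C` bijectively onto the open `2`-cell `b` of `D`, and let
`x₀` be a point of the circle. `IsRoot g c b x₀ v` says that `v` is the vertex that `c` has at the
place of its boundary circle corresponding to `x₀`: when `x → x₀` inside the open disc, the point of
`c` which lies over the point of `b` with coordinate `x` tends to `v`. -/
def IsRoot (g : C → D) (c : Cell C 2) (b : Cell D 2) (x₀ : Fin 2 → ℝ) (v : Cell C 0) : Prop :=
  ∀ N ∈ 𝓝 (point v), ∃ W ∈ 𝓝 x₀, ∀ x ∈ W ∩ ball 0 1, ∀ y ∈ openCell c,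
    g y = charMap b x → y ∈ N

end Cells

/-- The complexes `B_{X,P}`: a `2`-complex with exactly one `0`-cell, whose `1`-cells are labeled
bijectively by `X` and whose `2`-cells are labeled bijectively by `P`, together with a base point
`x₀` on the boundary circle of each `2`-cell which the attaching map sends to the `0`-cell. -/
structure LabelComplex (X P B : Type*) [TopologicalSpace B] [CWComplex (univ : Set B)]
    [IsTwoComplex B] where
  vertex : Cell B 0
  vertex_unique : ∀ v : Cell B 0, v = vertex
  edge : X ≃ Cell B 1
  face : P ≃ Cell B 2
  basePoint : P → (Fin 2 → ℝ)
  basePoint_mem : ∀ ρ, basePoint ρ ∈ sphere (0 : Fin 2 → ℝ) 1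
  charMap_basePoint : ∀ ρ, charMap (face ρ) (basePoint ρ) = point vertex

section Roots

variable {C B : Type*} [TopologicalSpace C] [CWComplex (univ : Set C)]
  [TopologicalSpace B] [CWComplex (univ : Set B)]

lemma cell_eq_of_mem {n m : ℕ} {c : Cell C n} {d : Cell C m} {y : C}
    (hc : y ∈ openCell c) (hd : y ∈ openCell d) :
    (⟨n, c⟩ : Σ n, Cell C n) = ⟨m, d⟩ := by
  by_contra h
  exact disjoint_left.1 (RelCWComplex.disjoint_openCell_of_ne h) hc hd

lemma exists_mem_openCell (y : C) : ∃ (n : ℕ) (c : Cell C n), y ∈ openCell c := by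
  have h := CWComplex.iUnion_openCell_eq_complex (C := (univ : Set C))
  have hy : y ∈ ⋃ (n : ℕ) (j : Cell C n), RelCWComplex.openCell n j := by rw [h]; trivial
  simpa only [mem_iUnion] using hy

lemma mem_openCell_point (v : Cell C 0) : point v ∈ openCell v :=
  mem_image_of_mem _ (by simp)

lemma eq_point_of_mem {v : Cell C 0} {y : C} (h : y ∈ openCell v) : y = point v := by
  obtain ⟨x, -, rfl⟩ := h
  rw [Subsingleton.elim x 0]

/-- An immersion pulls `0`-cells back to `0`-cells. -/
lemma IsImmersion.exists_point_of_eq {g : C → B} (hg : IsImmersion g) {y : C} {w : Cell B 0}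
    (h : g y = point w) : ∃ v : Cell C 0, y = point v := by
  obtain ⟨n, c, hc⟩ := exists_mem_openCell y
  have h1 : point w ∈ openCell (hg.onCell c) := h ▸ (hg.bijOn c).mapsTo hc
  have h2 := cell_eq_of_mem h1 (mem_openCell_point w)
  obtain rfl : n = 0 := congrArg Sigma.fst h2
  exact ⟨c, eq_point_of_mem hc⟩

/-- A point of a closed cell which an immersion maps into the open image cell lies in the open
cell. -/
lemma IsImmersion.mem_openCell [T2Space C] {g : C → B} (hg : IsImmersion g) {n : ℕ} {c : Cell C n} {y : C}
    (hy : y ∈ RelCWComplex.closedCell n c) (h : g y ∈ openCell (hg.onCell c)) :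
    y ∈ openCell c := by
  obtain ⟨m, d, hd⟩ := exists_mem_openCell y
  have h2 := cell_eq_of_mem ((hg.bijOn d).mapsTo hd) h
  obtain rfl : m = n := congrArg Sigma.fst h2
  rw [← RelCWComplex.cellFrontier_union_openCell_eq_closedCell] at hy
  rcases hy with hy | hy
  · exact absurd hd (disjoint_left.1 (RelCWComplex.disjoint_skeletonLT_openCell le_rfl)
      (RelCWComplex.cellFrontier_subset_skeletonLT m c hy))
  · exact hy

/-- Roots exist. -/
lemma IsImmersion.exists_isRoot [T2Space C] [T2Space B] {g : C → B} (hg : IsImmersion g)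
    (c : Cell C 2) {x₀ : Fin 2 → ℝ} (hx₀ : x₀ ∈ sphere (0 : Fin 2 → ℝ) 1) {w : Cell B 0}
    (hw : charMap (hg.onCell c) x₀ = point w) :
    ∃ v : Cell C 0, IsRoot g c (hg.onCell c) x₀ v := by
  set b := hg.onCell c with hb
  have hbij : BijOn g (openCell c) (openCell b) := hg.bijOn c
  have hKc : IsCompact (RelCWComplex.closedCell 2 c) := RelCWComplex.isCompact_closedCell
  have hball : ∀ x ∈ ball (0 : Fin 2 → ℝ) 1, charMap b x ∈ openCell b :=
    fun x hx => mem_image_of_mem _ hx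
  have : Nonempty C := ⟨charMap c 0⟩
  choose! L hLc hLg using fun x (hx : x ∈ ball (0 : Fin 2 → ℝ) 1) => hbij.surjOn (hball x hx)
  have hLuniq : ∀ x ∈ ball (0 : Fin 2 → ℝ) 1, ∀ y ∈ openCell c, g y = charMap b x → y = L x :=
    fun x hx y hy h => hbij.injOn hy (hLc x hx) (h.trans (hLg x hx).symm)
  have hcont : ContinuousOn (charMap b) (closedBall 0 1) := RelCWComplex.continuousOn 2 b
  -- the set of parameters whose image avoids the image of a compact part of the closed cell
  have key : ∀ O : Set C, IsOpen O → ∀ x ∈ closedBall (0 : Fin 2 → ℝ) 1,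
      (∀ y ∈ RelCWComplex.closedCell 2 c, g y = charMap b x → y ∈ O) →
      ∀ᶠ z in 𝓝[ball 0 1] x, L z ∈ O := by
    intro O hO x hx h
    have hcomp : IsClosed (g '' (RelCWComplex.closedCell 2 c \ O)) :=
      ((hKc.diff hO).image hg.continuous).isClosed
    have hnot : charMap b x ∈ (g '' (RelCWComplex.closedCell 2 c \ O))ᶜ := by
      rintro ⟨y, ⟨hy, hyO⟩, hgy⟩
      exact hyO (h y hy hgy)
    have h1 : ∀ᶠ z in 𝓝[ball 0 1] x, charMap b z ∈ (g '' (RelCWComplex.closedCell 2 c \ O))ᶜ :=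
      ((hcont x hx).mono ball_subset_closedBall).eventually (hcomp.isOpen_compl.mem_nhds hnot)
    filter_upwards [h1, self_mem_nhdsWithin] with z hz hzb
    by_contra hzO
    exact hz ⟨L z, ⟨RelCWComplex.openCell_subset_closedCell 2 c (hLc z hzb), hzO⟩, hLg z hzb⟩
  have hLcont : ContinuousOn L (ball 0 1) := by
    intro x hx
    rw [ContinuousWithinAt, _root_.tendsto_nhds]
    intro O hO hxO
    refine key O hO x (ball_subset_closedBall hx) fun y hy hyx => ?_
    have : y ∈ openCell c := hg.mem_openCell hy (by rw [hyx]; exact hball x hx)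
    rw [hLuniq x hx y this hyx]
    exact hxO
  -- the fibre over the base point
  set S : Set C := RelCWComplex.closedCell 2 c ∩ g ⁻¹' {point w} with hS
  have hScomp : IsCompact S := hKc.inter_right (isClosed_singleton.preimage hg.continuous)
  have hSfin : S.Finite := by
    by_contra hinf
    obtain ⟨y, -, hacc⟩ := Set.Infinite.exists_accPt_of_subset_isCompact hinf hScomp subset_rfl
    obtain ⟨U, hU, hemb⟩ := hg.exists_isEmbedding y
    have hinjU : InjOn g U := injOn_iff_injective.2 hemb.injective
    rw [accPt_iff_nhds] at hacc
    obtain ⟨z, ⟨hzU, hzS⟩, hzy⟩ := hacc U hU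
    have hyS : y ∈ S := by
      have : y ∈ closure S := mem_closure_iff_nhds.2 fun t ht => by
        obtain ⟨z, hz, -⟩ := hacc t ht
        exact ⟨z, hz⟩
      rwa [hScomp.isClosed.closure_eq] at this
    exact hzy (hinjU hzU (mem_of_mem_nhds hU) (hzS.2.trans hyS.2.symm))
  obtain ⟨U, hU, hdisj⟩ := hSfin.t2_separation
  have hx₀' : x₀ ∈ closedBall (0 : Fin 2 → ℝ) 1 := sphere_subset_closedBall hx₀
  have hneBot : (𝓝[ball (0 : Fin 2 → ℝ) 1] x₀).NeBot := by
    rw [← mem_closure_iff_nhdsWithin_neBot, closure_ball _ one_ne_zero]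
    exact hx₀'
  have hcover : ∀ y ∈ RelCWComplex.closedCell 2 c, g y = charMap b x₀ → y ∈ S :=
    fun y hy h => ⟨hy, h.trans hw⟩
  have hev := key (⋃ y ∈ S, U y) (isOpen_biUnion fun y _ => (hU y).2) x₀ hx₀'
    fun y hy h => mem_biUnion (hcover y hy h) (hU y).1
  obtain ⟨ε, hε, hεsub⟩ := Metric.mem_nhdsWithin_iff.1 hev
  have hconn : IsPreconnected (L '' (ball x₀ ε ∩ ball 0 1)) :=
    (((convex_ball x₀ ε).inter (convex_ball 0 1)).isPreconnected).image L
      (hLcont.mono inter_subset_right)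
  have hmem : ball x₀ ε ∩ ball (0 : Fin 2 → ℝ) 1 ∈ 𝓝[ball (0 : Fin 2 → ℝ) 1] x₀ :=
    inter_mem (mem_nhdsWithin_of_mem_nhds (ball_mem_nhds x₀ hε)) self_mem_nhdsWithin
  obtain ⟨x₁, hx₁⟩ := hneBot.nonempty_of_mem hmem
  obtain ⟨y₀, hy₀S, hy₀⟩ : ∃ y ∈ S, L x₁ ∈ U y := by simpa using hεsub hx₁
  have hsub : L '' (ball x₀ ε ∩ ball 0 1) ⊆ U y₀ := by
    refine hconn.subset_left_of_subset_union (v := ⋃ y ∈ S \ {y₀}, U y) (hU y₀).2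
      (isOpen_biUnion fun y _ => (hU y).2) ?_ ?_ ⟨L x₁, mem_image_of_mem _ hx₁, hy₀⟩
    · simp only [disjoint_iUnion_right]
      intro y hy
      exact hdisj hy₀S hy.1 fun h => hy.2 h.symm
    · rintro _ ⟨x, hx, rfl⟩
      obtain ⟨y, hyS, hy⟩ : ∃ y ∈ S, L x ∈ U y := by simpa using hεsub hx
      by_cases h : y = y₀
      · exact Or.inl (h ▸ hy)
      · exact Or.inr (mem_biUnion (show y ∈ S \ {y₀} from ⟨hyS, h⟩) hy)
  obtain ⟨v, hv⟩ := hg.exists_point_of_eq hy₀S.2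
  refine ⟨v, fun N hN => ?_⟩
  rw [← hv] at hN
  obtain ⟨O, hON, hO, hyO⟩ := mem_nhds_iff.1 hN
  have hev2 := key (O ∪ ⋃ y ∈ S \ {y₀}, U y)
    (hO.union (isOpen_biUnion fun y _ => (hU y).2)) x₀ hx₀' fun y hy h => by
      by_cases hyy : y = y₀
      · exact Or.inl (hyy ▸ hyO)
      · exact Or.inr (mem_biUnion (show y ∈ S \ {y₀} from ⟨hcover y hy h, hyy⟩) (hU y).1)
  obtain ⟨W, hW, hWsub⟩ := mem_nhdsWithin_iff_exists_mem_nhds_inter.1 (inter_mem hev2 hmem)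
  refine ⟨W, hW, fun x hx y hy hyx => ?_⟩
  rw [hLuniq x hx.2 y hy hyx]
  obtain ⟨h1, h2⟩ := hWsub hx
  have h3 : L x ∈ U y₀ := hsub (mem_image_of_mem _ h2)
  rcases h1 with h1 | h1
  · exact hON h1
  · simp only [mem_iUnion] at h1
    obtain ⟨y', hy', h4⟩ := h1
    exact absurd h4 (disjoint_left.1 (hdisj hy₀S hy'.1 fun h => hy'.2 h.symm) h3)

/-- The root is unique. -/
lemma IsRoot.unique [T2Space C] {g : C → B} {c : Cell C 2} {b : Cell B 2}
    (hbij : BijOn g (openCell c) (openCell b)) {x₀ : Fin 2 → ℝ}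
    (hx₀ : x₀ ∈ sphere (0 : Fin 2 → ℝ) 1) {v v' : Cell C 0}
    (h : IsRoot g c b x₀ v) (h' : IsRoot g c b x₀ v') : v = v' := by
  by_contra hne
  have hpt : point v ≠ point v' := fun hp => hne (by
    have := cell_eq_of_mem (mem_openCell_point v) (hp ▸ mem_openCell_point v')
    simpa using this)
  obtain ⟨N, N', hN, hN', hd⟩ := t2_separation_nhds hpt
  obtain ⟨W, hW, h1⟩ := h N hN
  obtain ⟨W', hW', h2⟩ := h' N' hN'
  have hcl : x₀ ∈ closure (ball (0 : Fin 2 → ℝ) 1) := by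
    rw [closure_ball _ one_ne_zero]
    exact sphere_subset_closedBall hx₀
  obtain ⟨x, ⟨hxW, hxW'⟩, hxb⟩ := mem_closure_iff_nhds.1 hcl _ (inter_mem hW hW')
  obtain ⟨y, hy, hgy⟩ := hbij.surjOn (mem_image_of_mem _ hxb)
  exact disjoint_left.1 hd (h1 x ⟨hxW, hxb⟩ y hy hgy) (h2 x ⟨hxW', hxb⟩ y hy hgy)

end Roots

/-- The alphabet `X ∪ X⁻¹ ∪ P`: `edge x true` is `x`, `edge x false` is `x⁻¹`. -/
inductive Letter (X P : Type*) where
  | edge (x : X) (positive : Bool)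
  | face (ρ : P)

/-- The involution of the alphabet: it exchanges `x` and `x⁻¹`, and `ρ⁻¹ = ρ` for `ρ ∈ P`. -/
def Letter.inv {X P : Type*} : Letter X P → Letter X P
  | .edge x s => .edge x (!s)
  | .face ρ => .face ρ

section Labels

variable {X P C B : Type*} [TopologicalSpace C] [CWComplex (univ : Set C)]
  [TopologicalSpace B] [CWComplex (univ : Set B)] [IsTwoComplex B]

/-- The label in `X ∪ X⁻¹` that an immersion `g` into `B_{X,P}` induces on a directed edge. -/
noncomputable def edgeLabel (𝓑 : LabelComplex X P B) {g : C → B} (hg : IsImmersion g)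
    (e : DirEdge C) : X × Bool :=
  (𝓑.edge.symm (hg.onDirEdge e).1, (hg.onDirEdge e).2)

/-- The label in `P` that an immersion `g` into `B_{X,P}` induces on a `2`-cell. -/
noncomputable def faceLabel (𝓑 : LabelComplex X P B) {g : C → B} (hg : IsImmersion g)
    (c : Cell C 2) : P :=
  𝓑.face.symm (hg.onCell c)

lemma exists_root [IsTwoComplex C] (𝓑 : LabelComplex X P B) {g : C → B} (hg : IsImmersion g)
    (c : Cell C 2) :
    ∃ v : Cell C 0, IsRoot g c (hg.onCell c) (𝓑.basePoint (faceLabel 𝓑 hg c)) v :=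
  hg.exists_isRoot c (𝓑.basePoint_mem _) (w := 𝓑.vertex) (by
    have := 𝓑.charMap_basePoint (faceLabel 𝓑 hg c)
    rwa [faceLabel, Equiv.apply_symm_apply] at this)

/-- The root `α(c)` of a `2`-cell `c`, with respect to the labeling induced by `g`. -/
noncomputable def root [IsTwoComplex C] (𝓑 : LabelComplex X P B) {g : C → B} (hg : IsImmersion g)
    (c : Cell C 2) : Cell C 0 :=
  (exists_root 𝓑 hg c).choose

/-- Composition of immersions. -/
lemma IsImmersion.comp {C D E : Type*} [TopologicalSpace C] [CWComplex (univ : Set C)]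
    [TopologicalSpace D] [CWComplex (univ : Set D)] [TopologicalSpace E]
    [CWComplex (univ : Set E)] {g : D → E} {f : C → D} (hg : IsImmersion g) (hf : IsImmersion f) :
    IsImmersion (g ∘ f) where
  continuous := hg.continuous.comp hf.continuous
  exists_bijOn n c := ⟨hg.onCell (hf.onCell c), (hg.bijOn _).comp (hf.bijOn c)⟩
  exists_isEmbedding y := by
    obtain ⟨U, hU, hfU⟩ := hf.exists_isEmbedding y
    obtain ⟨V, hV, hgV⟩ := hg.exists_isEmbedding (f y)
    refine ⟨U ∩ f ⁻¹' V, inter_mem hU (hf.continuous.continuousAt hV), ?_⟩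
    have h1 : IsEmbedding (fun z : ↥(U ∩ f ⁻¹' V) => f z) :=
      hfU.comp (IsEmbedding.inclusion inter_subset_left)
    have h2 : IsEmbedding (fun y : ↥(U ∩ f ⁻¹' V) => (⟨f y, y.2.2⟩ : V)) :=
      h1.codRestrict V fun y => y.2.2
    exact hgV.comp h2

/-- An immersion `f : C → D` of `2`-complexes labeled by the immersions `gC` and `gD` into `B_{X,P}`
respects the labeling: it preserves the labels of directed edges and of `2`-cells,
and the labelings of `C` by `gD ∘ f` and by `gC` determine the same root of each `2`-cell. -/
structure RespectsLabeling {D : Type*} [TopologicalSpace D] [CWComplex (univ : Set D)]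
    [IsTwoComplex C] (𝓑 : LabelComplex X P B) {gC : C → B} (hgC : IsImmersion gC)
    {gD : D → B} (hgD : IsImmersion gD) {f : C → D} (hf : IsImmersion f) : Prop where
  edgeLabel_eq : ∀ e : DirEdge C, edgeLabel 𝓑 hgD (hf.onDirEdge e) = edgeLabel 𝓑 hgC e
  faceLabel_eq : ∀ c : Cell C 2, faceLabel 𝓑 hgD (hf.onCell c) = faceLabel 𝓑 hgC c
  root_eq : ∀ c : Cell C 2, root 𝓑 (hgD.comp hf) c = root 𝓑 hgC c

end Labels

/-- Graphs labeled over `X ∪ P`: digraphs with an involution on the edges (the inverse edge)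
and a labeling of the edges by `X ∪ X⁻¹ ∪ P` which is consistent with the involution. -/
structure LabeledGraph (X P : Type*) where
  V : Type*
  E : Type*
  init : E → V
  ter : E → V
  inv : E → E
  label : E → Letter X P
  inv_inv : ∀ e, inv (inv e) = e
  init_inv : ∀ e, init (inv e) = ter e
  label_inv : ∀ e, label (inv e) = (label e).inv

/-- A label-respecting immersion of labeled graphs: a label-preserving graph
morphism that is injective on the set of edges starting at each vertex. -/
structure GraphImmersion {X P : Type*} (Γ Δ : LabeledGraph X P) where
  onV : Γ.V → Δ.V
  onE : Γ.E → Δ.E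
  init_onE : ∀ e, Δ.init (onE e) = onV (Γ.init e)
  ter_onE : ∀ e, Δ.ter (onE e) = onV (Γ.ter e)
  inv_onE : ∀ e, onE (Γ.inv e) = Δ.inv (onE e)
  label_onE : ∀ e, Δ.label (onE e) = Γ.label e
  injOn_star : ∀ v, InjOn onE {e | Γ.init e = v}

/-- The labeled graph `Γ_C` of a `2`-complex `C` labeled by an immersion `g` into `B_{X,P}`:
its vertices are the `0`-cells of `C`, its edges are the directed edges of `C` and, for each
`2`-cell `c`, a loop `e_c` (its own inverse) at the root of `c`, labeled by the label of `c`. -/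
noncomputable def graphOf {X P C B : Type*} [TopologicalSpace C] [CWComplex (univ : Set C)]
    [IsTwoComplex C] [TopologicalSpace B] [CWComplex (univ : Set B)] [IsTwoComplex B]
    (𝓑 : LabelComplex X P B) {g : C → B} (hg : IsImmersion g) : LabeledGraph X P where
  V := Cell C 0
  E := DirEdge C ⊕ Cell C 2
  init := Sum.elim (fun e => e.init) (root 𝓑 hg)
  ter := Sum.elim (fun e => e.rev.init) (root 𝓑 hg)
  inv := Sum.map (fun e => e.rev) id
  label := Sum.elim (fun e => .edge (edgeLabel 𝓑 hg e).1 (edgeLabel 𝓑 hg e).2)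
    (fun c => .face (faceLabel 𝓑 hg c))
  inv_inv := by rintro (⟨e, s⟩ | c) <;> simp [DirEdge.rev]
  init_inv := by rintro (e | c) <;> rfl
  label_inv := by
    rintro (⟨e, s⟩ | c)
    · simp only [Sum.map_inl, Sum.elim_inl, Letter.inv, DirEdge.rev, edgeLabel,
        IsImmersion.onDirEdge]
      split_ifs <;> rfl
    · rfl

end TwoComplexes

/-! A corner of a cell `c` is the vertex reached in `c` when the point over `x` is followed as `x`
tends to a boundary point `x₀` of the image cell. Initial vertices of directed edges and roots of
`2`-cells are both corners, and the proof rests on how corners behave under locally injective maps.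

From complexes to graphs: an immersion `f` acts on cells. By continuity it carries corners to
corners (`IsCorner.apply_point`, `IsCorner.push`), so it respects initial vertices and roots. If two
cells have the same image and the same corner `v`, they contain points arbitrarily near `v` with the
same image, so local injectivity makes the cells equal (`IsCorner.eq_of_same_image`). This gives
injectivity on stars.

From graphs to complexes: a graph immersion assigns to each cell `c` a cell `δ c` with the same
image in `B`. On the open cell `c` put `f = (gD on δ c)⁻¹ ∘ gC`, so that `gD ∘ f = gC`. Labels and
roots then agree, and `f` is an immersion once it is continuous, which may be checked on closed
cells. On an open disc `f` is a lift of `gC ∘ charMap c` through `gD`; it extends to the closed disc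
because closed cells of `D` are compact and `gD` is locally injective
(`exists_continuousOn_closure_lift`). It remains to see that the extension agrees with `f` on the
boundary. For an edge, compatibility with initial vertices settles both ends. For a `2`-cell, the
extension and `f` are two lifts over the boundary circle; they agree at a point lying over the root,
hence everywhere, since the circle is connected and `gD` is locally injective. -/

namespace TwoComplexes

/-! ### Extending lifts through locally injective maps of compact spaces -/

section Lifting

variable {K E B : Type*} [TopologicalSpace K] [CompactSpace K] [TopologicalSpace B] [T2Space B]
  {g : K → B} {h : E → B} {L : E → K} {A : Set E} {x : E}

/-- If a lift `L` of `h` through a map `g` from a compact space is given on `A`, then near a point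
`x` the values of `L` are close to the fibre of `g` over `h x`. -/
lemma eventually_lift_mem_of_fiber_subset [TopologicalSpace E] (hg : Continuous g)
    (hh : ContinuousWithinAt h A x) (hL : EqOn (g ∘ L) h A) {O : Set K} (hO : IsOpen O)
    (hfib : ∀ y, g y = h x → y ∈ O) : ∀ᶠ z in 𝓝[A] x, L z ∈ O := by
  have hcl : IsClosed (g '' Oᶜ) := (hO.isClosed_compl.isCompact.image hg).isClosed
  have hnot : h x ∈ (g '' Oᶜ)ᶜ := by
    rintro ⟨y, hy, hgy⟩
    exact hy (hfib y hgy)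
  filter_upwards [hh.eventually (hcl.isOpen_compl.mem_nhds hnot), self_mem_nhdsWithin] with z hz hzA
  by_contra hzO
  exact hz ⟨L z, hzO, hL hzA⟩

lemma continuousWithinAt_lift [TopologicalSpace E] (hg : Continuous g)
    (hh : ContinuousWithinAt h A x) (hL : EqOn (g ∘ L) h A) (hfib : ∀ y, g y = h x → y = L x) :
    ContinuousWithinAt L A x := by
  rw [ContinuousWithinAt, _root_.tendsto_nhds]
  intro O hO hxO
  exact eventually_lift_mem_of_fiber_subset hg hh hL hO fun y hy => (hfib y hy).symm ▸ hxO

/-- An infinite fibre in a compact space would have an accumulation point, and `g` is not injective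
near it. -/
lemma finite_fiber_of_isLocallyInjective (hg : Continuous g) (hinj : IsLocallyInjective g)
    (b : B) : (g ⁻¹' {b}).Finite := by
  by_contra hinf
  have hcl : IsClosed (g ⁻¹' {b}) := isClosed_singleton.preimage hg
  obtain ⟨y, hy, hacc⟩ :=
    Set.Infinite.exists_accPt_of_subset_isCompact hinf hcl.isCompact subset_rfl
  obtain ⟨U, hU, hyU, hinjU⟩ := hinj y
  obtain ⟨z, ⟨hzU, hzS⟩, hzy⟩ := accPt_iff_nhds.1 hacc U (hU.mem_nhds hyU)
  exact hzy (hinjU hzU hyU (hzS.trans hy.symm))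

variable [T2Space K] [NormedAddCommGroup E] [NormedSpace ℝ E]

/-- Separate the finitely many points of the fibre over `h x` by disjoint open sets. Near `x` the
values of `L` lie in their union, and convexity makes `ball x ε ∩ A` connected, so they stay in a
single one of these sets. Its fibre point is the limit. -/
lemma exists_tendsto_lift (hg : Continuous g) (hinj : IsLocallyInjective g) (hA : Convex ℝ A)
    (hx : x ∈ closure A) (hh : ContinuousWithinAt h A x) (hLc : ContinuousOn L A)
    (hL : EqOn (g ∘ L) h A) : ∃ y, Tendsto L (𝓝[A] x) (𝓝 y) := by
  have hne : (𝓝[A] x).NeBot := mem_closure_iff_nhdsWithin_neBot.1 hx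
  set S := g ⁻¹' {h x} with hS
  obtain ⟨U, hU, hdisj⟩ := (finite_fiber_of_isLocallyInjective hg hinj (h x)).t2_separation
  have hev := eventually_lift_mem_of_fiber_subset hg hh hL (O := ⋃ y ∈ S, U y)
    (isOpen_biUnion fun y _ => (hU y).2) fun y hy => mem_biUnion hy (hU y).1
  obtain ⟨ε, hε, hsub⟩ := Metric.mem_nhdsWithin_iff.1 hev
  have hmem : ball x ε ∩ A ∈ 𝓝[A] x :=
    inter_mem (mem_nhdsWithin_of_mem_nhds (ball_mem_nhds x hε)) self_mem_nhdsWithin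
  have hconn : IsPreconnected (L '' (ball x ε ∩ A)) :=
    ((convex_ball x ε).inter hA).isPreconnected.image L (hLc.mono inter_subset_right)
  obtain ⟨x₁, hx₁⟩ := hne.nonempty_of_mem hmem
  obtain ⟨y₀, hy₀S, hy₀⟩ : ∃ y ∈ S, L x₁ ∈ U y := by simpa using hsub hx₁
  have hopen : IsOpen (⋃ y ∈ S \ {y₀}, U y) := isOpen_biUnion fun y _ => (hU y).2
  have hdisj' : Disjoint (U y₀) (⋃ y ∈ S \ {y₀}, U y) := by
    simp only [disjoint_iUnion_right]
    exact fun y hy => hdisj hy₀S hy.1 fun h => hy.2 h.symm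
  have hsub' : L '' (ball x ε ∩ A) ⊆ U y₀ := by
    refine hconn.subset_left_of_subset_union (hU y₀).2 hopen hdisj' ?_
      ⟨L x₁, mem_image_of_mem _ hx₁, hy₀⟩
    rintro _ ⟨z, hz, rfl⟩
    obtain ⟨y, hyS, hy⟩ : ∃ y ∈ S, L z ∈ U y := by simpa using hsub hz
    by_cases h : y = y₀
    · exact Or.inl (h ▸ hy)
    · exact Or.inr (mem_biUnion (show y ∈ S \ {y₀} from ⟨hyS, h⟩) hy)
  refine ⟨y₀, _root_.tendsto_nhds.2 fun O hO hyO => ?_⟩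
  -- Shrinking only the set around `y₀` still covers the fibre; since `L` avoids the other sets near
  -- `x`, it must enter `O`.
  have hev' := eventually_lift_mem_of_fiber_subset hg hh hL (O := O ∪ ⋃ y ∈ S \ {y₀}, U y)
    (hO.union hopen) fun y hy => by
      by_cases h : y = y₀
      · exact Or.inl (h ▸ hyO)
      · exact Or.inr (mem_biUnion (show y ∈ S \ {y₀} from ⟨hy, h⟩) (hU y).1)
  filter_upwards [hev', hmem] with z hz hz'
  exact hz.resolve_right fun hz2 =>
    disjoint_left.1 hdisj' (hsub' (mem_image_of_mem L hz')) hz2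

/-- A lift through a locally injective map from a compact Hausdorff space, given on a convex set,
extends continuously to the closure. -/
lemma exists_continuousOn_closure_lift (hg : Continuous g) (hinj : IsLocallyInjective g)
    (hA : Convex ℝ A) (hh : ContinuousOn h (closure A)) (hLc : ContinuousOn L A)
    (hL : EqOn (g ∘ L) h A) :
    ∃ F : E → K, ContinuousOn F (closure A) ∧ EqOn F L A ∧ EqOn (g ∘ F) h (closure A) := by
  have hF : ContinuousOn (extendFrom A L) (closure A) :=
    continuousOn_extendFrom subset_rfl fun x hx =>
      exists_tendsto_lift hg hinj hA hx ((hh x hx).mono subset_closure) hLc hL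
  have hFL : EqOn (extendFrom A L) L A := fun x hx =>
    extendFrom_eq (subset_closure hx) (hLc x hx)
  refine ⟨extendFrom A L, hF, hFL, ?_⟩
  refine EqOn.of_subset_closure (s := A) (fun x hx => ?_) (hg.comp_continuousOn hF) hh
    subset_closure subset_rfl
  rw [Function.comp_apply, hFL hx]
  exact hL hx

end Lifting

/-- A function on a compact image is continuous if its composition with the parametrization is. -/
lemma continuousOn_image_of_comp {E C D : Type*} [TopologicalSpace E] [TopologicalSpace C]
    [T2Space C] [TopologicalSpace D] {K : Set E} (hK : IsCompact K) {p : E → C}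
    (hp : ContinuousOn p K) {f : C → D} (hf : ContinuousOn (f ∘ p) K) :
    ContinuousOn f (p '' K) := by
  have : CompactSpace K := isCompact_iff_compactSpace.1 hK
  rw [continuousOn_iff_continuous_domRestrict] at hf ⊢
  set q : K → p '' K := fun x => ⟨p x, mem_image_of_mem p x.2⟩
  have hq : Continuous q := (continuousOn_iff_continuous_domRestrict.1 hp).subtype_mk _
  have hsurj : Function.Surjective q := by
    rintro ⟨_, x, hx, rfl⟩
    exact ⟨⟨x, hx⟩, rfl⟩
  exact (hq.isClosedMap.isQuotientMap hq hsurj).continuous_iff.2 hf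

/-! ### Monotone maps of the open interval and its ends -/

section Intervals

lemma tendsto_neg_one_of_strictMonoOn {α : Type*} {l : Filter α} {h : ℝ → ℝ}
    (hmaps : MapsTo h (Ioo (-1) 1) (Ioo (-1) 1)) (hmono : StrictMonoOn h (Ioo (-1) 1))
    {x z : α → ℝ} (hz : ∀ᶠ a in l, z a ∈ Ioo (-1) 1) (hzx : ∀ᶠ a in l, h (z a) = x a)
    (hx : Tendsto x l (𝓝 (-1))) : Tendsto z l (𝓝 (-1)) := by
  refine tendsto_order.2 ⟨fun a ha => hz.mono fun i hi => ha.trans hi.1, fun a ha => ?_⟩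
  -- The minimum with `0` keeps the test point inside the interval even when `a ≥ 1`.
  have hm : min a 0 ∈ Ioo (-1 : ℝ) 1 := ⟨by simp [ha], by simp⟩
  filter_upwards [hz, hzx, hx.eventually (gt_mem_nhds (hmaps hm).1)] with i hi hzxi hxi
  rw [← hzxi] at hxi
  exact ((hmono.lt_iff_lt hi hm).1 hxi).trans_le (min_le_left _ _)

lemma neg_mem_Ioo_neg_one_one {t : ℝ} (ht : t ∈ Ioo (-1 : ℝ) 1) : -t ∈ Ioo (-1 : ℝ) 1 :=
  ⟨by linarith [ht.2], by linarith [ht.1]⟩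

/-- A monotone bijection between open intervals respects the ends, an antitone one exchanges
them. -/
lemma tendsto_end_of_strictMonoOn_or {α : Type*} {l : Filter α} {h : ℝ → ℝ}
    (hmaps : MapsTo h (Ioo (-1) 1) (Ioo (-1) 1)) {s s' : Bool}
    (hmono : StrictMonoOn h (Ioo (-1) 1) ∧ s' = s ∨ StrictAntiOn h (Ioo (-1) 1) ∧ s' = !s)
    {x z : α → ℝ} (hz : ∀ᶠ a in l, z a ∈ Ioo (-1) 1) (hzx : ∀ᶠ a in l, h (z a) = x a)
    (hx : Tendsto x l (𝓝 (if s' then -1 else 1))) : Tendsto z l (𝓝 (if s then -1 else 1)) := by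
  have hz' : ∀ᶠ a in l, -z a ∈ Ioo (-1 : ℝ) 1 := hz.mono fun a ha => neg_mem_Ioo_neg_one_one ha
  -- Each of the four cases reduces to the end `-1` and an increasing map by reflecting the source,
  -- the target, both or neither.
  rcases hmono with ⟨hmono, rfl⟩ | ⟨hanti, rfl⟩
  · cases s'
    · have := tendsto_neg_one_of_strictMonoOn (h := fun t => -h (-t)) (x := fun a => -x a)
        (z := fun a => -z a)
        (fun t ht => neg_mem_Ioo_neg_one_one (hmaps (neg_mem_Ioo_neg_one_one ht)))
        (fun t ht u hu htu => neg_lt_neg (hmono (neg_mem_Ioo_neg_one_one hu)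
          (neg_mem_Ioo_neg_one_one ht) (neg_lt_neg htu))) hz'
        (hzx.mono fun a ha => by simp [ha]) (by simpa using hx.neg)
      simpa using this.neg
    · simpa using tendsto_neg_one_of_strictMonoOn hmaps hmono hz hzx (by simpa using hx)
  · cases s
    · have := tendsto_neg_one_of_strictMonoOn (h := fun t => h (-t)) (x := x)
        (z := fun a => -z a) (fun t ht => hmaps (neg_mem_Ioo_neg_one_one ht))
        (fun t ht u hu htu => hanti (neg_mem_Ioo_neg_one_one hu)
          (neg_mem_Ioo_neg_one_one ht) (neg_lt_neg htu)) hz'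
        (hzx.mono fun a ha => by simp [ha]) (by simpa using hx)
      simpa using this.neg
    · have := tendsto_neg_one_of_strictMonoOn (h := fun t => -h t) (x := fun a => -x a)
        (z := z) (fun t ht => neg_mem_Ioo_neg_one_one (hmaps ht))
        (fun t ht u hu htu => neg_lt_neg (hanti ht hu htu)) hz
        (hzx.mono fun a ha => by simp [ha]) (by simpa using hx.neg)
      simpa using this

lemma not_strictMonoOn_of_strictAntiOn {h : ℝ → ℝ} (hanti : StrictAntiOn h (Ioo (-1) 1)) :
    ¬ StrictMonoOn h (Ioo (-1) 1) := fun hmono => by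
  have h0 : (0 : ℝ) ∈ Ioo (-1 : ℝ) 1 := by norm_num
  have h1 : (1 / 2 : ℝ) ∈ Ioo (-1 : ℝ) 1 := by norm_num
  exact lt_asymm (hmono h0 h1 (by norm_num)) (hanti h0 h1 (by norm_num))

end Intervals

/-! ### Corners of cells -/

section Corners

variable {C D B : Type*} [TopologicalSpace C] [CWComplex (univ : Set C)]
  [TopologicalSpace D] [CWComplex (univ : Set D)] [TopologicalSpace B] [CWComplex (univ : Set B)]

lemma charMap_mem_openCell {n : ℕ} (c : Cell C n) {z : Fin n → ℝ} (hz : z ∈ ball 0 1) :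
    charMap c z ∈ openCell c := mem_image_of_mem _ hz

lemma charMap_symm_charMap {n : ℕ} (c : Cell C n) {z : Fin n → ℝ} (hz : z ∈ ball 0 1) :
    (charMap c).symm (charMap c z) = z :=
  (charMap c).left_inv (by rwa [RelCWComplex.source_eq])

lemma charMap_target {n : ℕ} (c : Cell C n) : (charMap c).target = openCell c := by
  rw [← (charMap c).image_source_eq_target, RelCWComplex.source_eq]
  rfl

lemma charMap_symm_mem {n : ℕ} (c : Cell C n) {y : C} (hy : y ∈ openCell c) :
    (charMap c).symm y ∈ ball (0 : Fin n → ℝ) 1 := by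
  obtain ⟨z, hz, rfl⟩ := hy
  rwa [charMap_symm_charMap c hz]

lemma charMap_charMap_symm {n : ℕ} (c : Cell C n) {y : C} (hy : y ∈ openCell c) :
    charMap c ((charMap c).symm y) = y :=
  (charMap c).right_inv (by rwa [charMap_target])

lemma eq_of_mem_openCell {n : ℕ} {c d : Cell C n} {y : C} (hc : y ∈ openCell c)
    (hd : y ∈ openCell d) : c = d := by
  simpa using cell_eq_of_mem hc hd

lemma point_injective : Function.Injective (point : Cell C 0 → C) := fun v w h =>
  eq_of_mem_openCell (mem_openCell_point v) (h ▸ mem_openCell_point w)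

namespace IsImmersion

lemma onCell_eq_of_mem {f : C → D} (hf : IsImmersion f) {n : ℕ} {c : Cell C n} {d : Cell D n}
    {y : C} (hy : y ∈ openCell c) (hd : f y ∈ openCell d) : hf.onCell c = d :=
  eq_of_mem_openCell ((hf.bijOn c).mapsTo hy) hd

lemma onCell_comp {g : D → B} {f : C → D} (hg : IsImmersion g) (hf : IsImmersion f) {n : ℕ}
    (c : Cell C n) : (hg.comp hf).onCell c = hg.onCell (hf.onCell c) :=
  have hc := charMap_mem_openCell c (mem_ball_self one_pos)
  onCell_eq_of_mem _ hc ((hg.bijOn _).mapsTo ((hf.bijOn c).mapsTo hc))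

lemma apply_point {f : C → D} (hf : IsImmersion f) (v : Cell C 0) :
    f (point v) = point (hf.onCell v) :=
  eq_point_of_mem ((hf.bijOn v).mapsTo (mem_openCell_point v))

lemma isLocallyInjective {f : C → D} (hf : IsImmersion f) : IsLocallyInjective f :=
  isLocallyInjective_iff_nhds.2 fun y =>
    let ⟨U, hU, h⟩ := hf.exists_isEmbedding y
    ⟨U, hU, injOn_iff_injective.2 h.injective⟩

end IsImmersion

lemma ball_neBot {n : ℕ} {x₀ : Fin n → ℝ} (hx₀ : x₀ ∈ closedBall 0 1) :
    (𝓝[ball (0 : Fin n → ℝ) 1] x₀).NeBot := by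
  rwa [← mem_closure_iff_nhdsWithin_neBot, closure_ball _ one_ne_zero]

/-- `IsRoot` for cells of any dimension: `c` has the vertex `v` at the place of its boundary
corresponding to the point `x₀` of the boundary of `b`. -/
def IsCorner (g : C → D) {n : ℕ} (c : Cell C n) (b : Cell D n) (x₀ : Fin n → ℝ) (v : Cell C 0) :
    Prop :=
  ∀ N ∈ 𝓝 (point v), ∃ W ∈ 𝓝 x₀, ∀ x ∈ W ∩ ball 0 1, ∀ y ∈ openCell c,
    g y = charMap b x → y ∈ N

/-- The filter is arbitrary because for `2`-cells the limit is taken along an ultrafilter. -/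
lemma IsCorner.tendsto {g : C → D} {n : ℕ} {c : Cell C n} {b : Cell D n} {x₀ : Fin n → ℝ}
    {v : Cell C 0} (h : IsCorner g c b x₀ v) {α : Type*} {l : Filter α} {x : α → (Fin n → ℝ)}
    {y : α → C} (hx : Tendsto x l (𝓝[ball 0 1] x₀)) (hy : ∀ᶠ a in l, y a ∈ openCell c)
    (hxy : ∀ᶠ a in l, g (y a) = charMap b (x a)) : Tendsto y l (𝓝 (point v)) := by
  intro N hN
  obtain ⟨W, hW, hWN⟩ := h N hN
  have hx' := hx (inter_mem (mem_nhdsWithin_of_mem_nhds hW) self_mem_nhdsWithin)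
  rw [mem_map] at hx' ⊢
  filter_upwards [hx', hy, hxy] with a h1 h2 h3
  exact hWN _ h1 _ h2 h3

lemma IsCorner.of_tendsto {g : C → D} {n : ℕ} {c : Cell C n} {b : Cell D n} {x₀ : Fin n → ℝ}
    {v : Cell C 0} (hbij : BijOn g (openCell c) (openCell b)) {y : (Fin n → ℝ) → C}
    (hy : ∀ x ∈ ball 0 1, y x ∈ openCell c ∧ g (y x) = charMap b x)
    (h : Tendsto y (𝓝[ball 0 1] x₀) (𝓝 (point v))) : IsCorner g c b x₀ v := by
  intro N hN
  obtain ⟨W, hW, hWN⟩ := mem_nhdsWithin_iff_exists_mem_nhds_inter.1 (h hN)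
  refine ⟨W, hW, fun x hx y' hy' hgy => ?_⟩
  rw [hbij.injOn hy' (hy x hx.2).1 (hgy.trans (hy x hx.2).2.symm)]
  exact hWN hx

/-- This is the inverse of `g` on the open cell, read in disc coordinates; no continuity of `z` is
asserted. -/
lemma exists_lift_coord {g : C → D} {n : ℕ} {c : Cell C n} {b : Cell D n}
    (hbij : BijOn g (openCell c) (openCell b)) : ∃ z : (Fin n → ℝ) → (Fin n → ℝ),
      ∀ x ∈ ball 0 1, z x ∈ ball 0 1 ∧ g (charMap c (z x)) = charMap b x := by
  have h : ∀ x ∈ ball (0 : Fin n → ℝ) 1, ∃ z ∈ ball (0 : Fin n → ℝ) 1,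
      g (charMap c z) = charMap b x := fun x hx => by
    obtain ⟨_, ⟨z, hz, rfl⟩, h⟩ := hbij.surjOn (charMap_mem_openCell b hx)
    exact ⟨z, hz, h⟩
  choose! z hz using h
  exact ⟨z, hz⟩

/-- As `x → x₀`, the points of `c` over `charMap d x` tend to `v`, while their images `charMap d x`
tend to `charMap d x₀`. -/
lemma IsCorner.apply_point [T2Space D] {f : C → D} (hf : Continuous f) {n : ℕ} {c : Cell C n}
    {d : Cell D n} (hbij : BijOn f (openCell c) (openCell d)) {x₀ : Fin n → ℝ}
    (hx₀ : x₀ ∈ closedBall 0 1) {v : Cell C 0} (h : IsCorner f c d x₀ v) :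
    f (point v) = charMap d x₀ := by
  have := ball_neBot hx₀
  obtain ⟨z, hz⟩ := exists_lift_coord hbij
  have h1 : Tendsto (fun x => charMap c (z x)) (𝓝[ball 0 1] x₀) (𝓝 (point v)) :=
    h.tendsto tendsto_id
      (eventually_mem_nhdsWithin.mono fun x hx => charMap_mem_openCell c (hz x hx).1)
      (eventually_mem_nhdsWithin.mono fun x hx => (hz x hx).2)
  have h2 : Tendsto (charMap d) (𝓝[ball 0 1] x₀) (𝓝 (charMap d x₀)) :=
    (RelCWComplex.continuousOn n d x₀ hx₀).mono ball_subset_closedBall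
  refine tendsto_nhds_unique ((hf.tendsto _).comp h1) (h2.congr' ?_)
  exact eventually_mem_nhdsWithin.mono fun x hx => (hz x hx).2.symm

/-- Two cells with the same image which have the same vertex at corresponding places are equal. -/
lemma IsCorner.eq_of_same_image {f : C → D} (hf : IsLocallyInjective f) {n : ℕ}
    {c₁ c₂ : Cell C n} {d : Cell D n} (h₁ : BijOn f (openCell c₁) (openCell d))
    (h₂ : BijOn f (openCell c₂) (openCell d)) {x₀ : Fin n → ℝ} (hx₀ : x₀ ∈ closedBall 0 1)
    {v : Cell C 0} (hv₁ : IsCorner f c₁ d x₀ v) (hv₂ : IsCorner f c₂ d x₀ v) : c₁ = c₂ := by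
  have := ball_neBot hx₀
  obtain ⟨U, hU, hinj⟩ := isLocallyInjective_iff_nhds.1 hf (point v)
  obtain ⟨z₁, hz₁⟩ := exists_lift_coord h₁
  obtain ⟨z₂, hz₂⟩ := exists_lift_coord h₂
  have t₁ : ∀ᶠ x in 𝓝[ball 0 1] x₀, charMap c₁ (z₁ x) ∈ U := hv₁.tendsto tendsto_id
    (eventually_mem_nhdsWithin.mono fun x hx => charMap_mem_openCell c₁ (hz₁ x hx).1)
    (eventually_mem_nhdsWithin.mono fun x hx => (hz₁ x hx).2) hU
  have t₂ : ∀ᶠ x in 𝓝[ball 0 1] x₀, charMap c₂ (z₂ x) ∈ U := hv₂.tendsto tendsto_id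
    (eventually_mem_nhdsWithin.mono fun x hx => charMap_mem_openCell c₂ (hz₂ x hx).1)
    (eventually_mem_nhdsWithin.mono fun x hx => (hz₂ x hx).2) hU
  -- For `x` close to `x₀` the points of both cells over `charMap d x` lie in `U`, where `f` is
  -- injective; so they coincide, and distinct open cells are disjoint.
  obtain ⟨x, hx₁, hx₂, hx⟩ :=
    (t₁.and (t₂.and eventually_mem_nhdsWithin)).exists
  have heq : charMap c₁ (z₁ x) = charMap c₂ (z₂ x) :=
    hinj hx₁ hx₂ ((hz₁ x hx).2.trans (hz₂ x hx).2.symm)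
  exact eq_of_mem_openCell (charMap_mem_openCell c₁ (hz₁ x hx).1)
    (heq ▸ charMap_mem_openCell c₂ (hz₂ x hx).1)

lemma IsCorner.push {g : D → B} {f : C → D} (hf : Continuous f) {n : ℕ} {c : Cell C n}
    {d : Cell D n} {b : Cell B n} (hbij : BijOn f (openCell c) (openCell d)) {x₀ : Fin n → ℝ}
    {v : Cell C 0} {w : Cell D 0} (hvw : f (point v) = point w)
    (h : IsCorner (g ∘ f) c b x₀ v) : IsCorner g d b x₀ w := by
  intro N hN
  obtain ⟨W, hW, hWN⟩ := h _ (hf.continuousAt.preimage_mem_nhds (hvw ▸ hN))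
  refine ⟨W, hW, fun x hx y hy hgy => ?_⟩
  obtain ⟨y', hy', rfl⟩ := hbij.surjOn hy
  exact hWN x hx y' hy' hgy

end Corners

/-! ### Directed edges under immersions -/

section Edges

variable {C D B : Type*} [TopologicalSpace C] [CWComplex (univ : Set C)]
  [TopologicalSpace D] [CWComplex (univ : Set D)] [TopologicalSpace B] [CWComplex (univ : Set B)]

/-- The end of `[-1, 1]` at which a directed edge starts. -/
noncomputable def startPoint (s : Bool) : Fin 1 → ℝ := fun _ => if s then -1 else 1

lemma startPoint_mem_sphere (s : Bool) : startPoint s ∈ sphere (0 : Fin 1 → ℝ) 1 := by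
  cases s <;> simp [startPoint, Pi.norm_def]

lemma exists_startPoint_eq {z : Fin 1 → ℝ} (hz : z ∈ sphere 0 1) : ∃ s, z = startPoint s := by
  have h : |z 0| = 1 := by simpa [Pi.norm_def] using hz
  rcases (abs_eq zero_le_one).1 h with h | h
  · exact ⟨false, funext fun i => by rw [Subsingleton.elim i 0, h]; rfl⟩
  · exact ⟨true, funext fun i => by rw [Subsingleton.elim i 0, h]; rfl⟩

lemma mem_ball_iff_Ioo {z : Fin 1 → ℝ} : z ∈ ball 0 1 ↔ z 0 ∈ Ioo (-1 : ℝ) 1 := by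
  rw [mem_Ioo, ← abs_lt]
  simp [Pi.norm_def]

lemma const_apply_zero (z : Fin 1 → ℝ) : (fun _ => z 0) = z :=
  funext fun i => by rw [Subsingleton.elim i 0]

lemma DirEdge.point_init (e : DirEdge C) : point e.init = charMap e.1 (startPoint e.2) :=
  (exists_point_eq e.1 (s := fun _ => if e.2 then -1 else 1)
    (by cases e.2 <;> simp [Pi.norm_def])).choose_spec.symm

/-- An immersion in the coordinates of an open `1`-cell and its image. -/
noncomputable def edgeCoord (f : C → D) (e : Cell C 1) (e' : Cell D 1) (t : ℝ) : ℝ :=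
  (charMap e').symm (f (charMap e fun _ => t)) 0

lemma edgeCoord_eq {f : C → D} {e : Cell C 1} {e' : Cell D 1} {z x : Fin 1 → ℝ}
    (hx : x ∈ ball 0 1) (h : f (charMap e z) = charMap e' x) : edgeCoord f e e' (z 0) = x 0 := by
  rw [edgeCoord, const_apply_zero, h, charMap_symm_charMap _ hx]

lemma mapsTo_edgeCoord {f : C → D} {e : Cell C 1} {e' : Cell D 1}
    (hbij : BijOn f (openCell e) (openCell e')) :
    MapsTo (edgeCoord f e e') (Ioo (-1) 1) (Ioo (-1) 1) := fun _ ht =>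
  mem_ball_iff_Ioo.1 (charMap_symm_mem e' (hbij.mapsTo
    (charMap_mem_openCell e (mem_ball_iff_Ioo.2 ht))))

/-- In coordinates the immersion is a continuous injective function on an interval. Hence failing to
preserve the direction means reversing it. -/
lemma strictMonoOn_or_strictAntiOn_edgeCoord {f : C → D} (hf : Continuous f) {e : Cell C 1}
    {e' : Cell D 1} (hbij : BijOn f (openCell e) (openCell e')) :
    StrictMonoOn (edgeCoord f e e') (Ioo (-1) 1) ∨
      StrictAntiOn (edgeCoord f e e') (Ioo (-1) 1) := by
  have hball : MapsTo (fun (t : ℝ) (_ : Fin 1) => t) (Ioo (-1) 1) (ball 0 1) := fun t ht =>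
    mem_ball_iff_Ioo.2 ht
  have hmaps : MapsTo (fun t : ℝ => f (charMap e fun _ => t)) (Ioo (-1) 1) (charMap e').target :=
    fun t ht => by
      rw [charMap_target]
      exact hbij.mapsTo (charMap_mem_openCell e (hball ht))
  refine ContinuousOn.strictMonoOn_of_injOn_Ioo (by norm_num) ?_ ?_
  · have h1 : ContinuousOn (fun t : ℝ => charMap e fun _ => t) (Ioo (-1) 1) :=
      ((RelCWComplex.continuousOn 1 e).mono ball_subset_closedBall).comp
        (continuous_pi fun _ => continuous_id).continuousOn hball
    exact (continuous_apply 0).comp_continuousOn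
      ((RelCWComplex.continuousOn_symm 1 e').comp (hf.comp_continuousOn h1) hmaps)
  · intro t ht u hu htu
    have h1 : (charMap e').symm (f (charMap e fun _ => t)) =
        (charMap e').symm (f (charMap e fun _ => u)) :=
      funext fun i => by rw [Subsingleton.elim i 0]; exact htu
    have h2 := (charMap e').symm.injOn (hmaps ht) (hmaps hu) h1
    have h3 := hbij.injOn (charMap_mem_openCell e (hball ht)) (charMap_mem_openCell e (hball hu)) h2
    have h4 := congrArg (charMap e).symm h3
    rw [charMap_symm_charMap _ (hball ht), charMap_symm_charMap _ (hball hu)] at h4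
    exact congrFun h4 0

/-- Near the start of the image edge, the coordinate of a lift is near the start of the edge. -/
lemma IsImmersion.tendsto_coord_start {g : C → D} (hg : IsImmersion g) (e : DirEdge C)
    {z : (Fin 1 → ℝ) → (Fin 1 → ℝ)} (hz : ∀ x ∈ ball 0 1, z x ∈ ball 0 1 ∧
      g (charMap e.1 (z x)) = charMap (hg.onDirEdge e).1 x) :
    Tendsto z (𝓝[ball 0 1] startPoint (hg.onDirEdge e).2) (𝓝 (startPoint e.2)) := by
  have hbij := hg.bijOn e.1
  have hz' : ∀ x ∈ ball (0 : Fin 1 → ℝ) 1, edgeCoord g e.1 (hg.onCell e.1) (z x 0) = x 0 :=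
    fun x hx => edgeCoord_eq hx (hz x hx).2
  have hmono : StrictMonoOn (edgeCoord g e.1 (hg.onCell e.1)) (Ioo (-1) 1) ∧
      (hg.onDirEdge e).2 = e.2 ∨ StrictAntiOn (edgeCoord g e.1 (hg.onCell e.1)) (Ioo (-1) 1) ∧
      (hg.onDirEdge e).2 = !e.2 := by
    rcases strictMonoOn_or_strictAntiOn_edgeCoord hg.continuous hbij with h | h
    · exact Or.inl ⟨h, if_pos h⟩
    · exact Or.inr ⟨h, if_neg (not_strictMonoOn_of_strictAntiOn h)⟩
  refine tendsto_pi_nhds.2 fun i => ?_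
  rw [Subsingleton.elim i 0]
  refine tendsto_end_of_strictMonoOn_or (mapsTo_edgeCoord hbij) hmono (x := fun x => x 0)
    (eventually_mem_nhdsWithin.mono fun x hx => mem_ball_iff_Ioo.1 (hz x hx).1)
    (eventually_mem_nhdsWithin.mono hz') ?_
  exact ((continuous_apply 0).tendsto _).mono_left nhdsWithin_le_nhds

lemma IsImmersion.isCorner_init {g : C → D} (hg : IsImmersion g) (e : DirEdge C) :
    IsCorner g e.1 (hg.onDirEdge e).1 (startPoint (hg.onDirEdge e).2) e.init := by
  obtain ⟨z, hz⟩ := exists_lift_coord (hg.bijOn e.1)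
  refine IsCorner.of_tendsto (hg.bijOn e.1) (y := fun x => charMap e.1 (z x))
    (fun x hx => ⟨charMap_mem_openCell _ (hz x hx).1, (hz x hx).2⟩) ?_
  rw [e.point_init]
  have h1 : ContinuousWithinAt (charMap e.1) (ball 0 1) (startPoint e.2) :=
    (RelCWComplex.continuousOn 1 e.1 _
      (sphere_subset_closedBall (startPoint_mem_sphere e.2))).mono ball_subset_closedBall
  exact h1.tendsto.comp (tendsto_nhdsWithin_iff.2 ⟨hg.tendsto_coord_start e hz,
    eventually_mem_nhdsWithin.mono fun x hx => (hz x hx).1⟩)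

lemma IsImmersion.init_onDirEdge [T2Space D] {f : C → D} (hf : IsImmersion f) (e : DirEdge C) :
    (hf.onDirEdge e).init = hf.onCell e.init := by
  apply point_injective
  rw [DirEdge.point_init, ← hf.apply_point]
  exact ((hf.isCorner_init e).apply_point hf.continuous (hf.bijOn e.1)
    (sphere_subset_closedBall (startPoint_mem_sphere _))).symm

lemma IsImmersion.onDirEdge_of_preservesDirection {f : C → D} (hf : IsImmersion f)
    {e : DirEdge C} (h : PreservesDirection f e.1 (hf.onCell e.1)) :
    hf.onDirEdge e = (hf.onCell e.1, e.2) := by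
  rw [onDirEdge, if_pos h]

lemma IsImmersion.onDirEdge_of_not_preservesDirection {f : C → D} (hf : IsImmersion f)
    {e : DirEdge C} (h : ¬ PreservesDirection f e.1 (hf.onCell e.1)) :
    hf.onDirEdge e = (hf.onCell e.1, !e.2) := by
  rw [onDirEdge, if_neg h]

lemma IsImmersion.onDirEdge_rev {f : C → D} (hf : IsImmersion f) (e : DirEdge C) :
    hf.onDirEdge e.rev = (hf.onDirEdge e).rev := by
  by_cases h : PreservesDirection f e.1 (hf.onCell e.1)
  · rw [hf.onDirEdge_of_preservesDirection h, hf.onDirEdge_of_preservesDirection (e := e.rev) h]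
    rfl
  · rw [hf.onDirEdge_of_not_preservesDirection h,
      hf.onDirEdge_of_not_preservesDirection (e := e.rev) h]
    rfl

lemma IsImmersion.onDirEdge_injective_right {f : C → D} (hf : IsImmersion f) {c : Cell C 1}
    {s t : Bool} (h : hf.onDirEdge (c, s) = hf.onDirEdge (c, t)) : s = t := by
  by_cases hp : PreservesDirection f c (hf.onCell c)
  · rw [hf.onDirEdge_of_preservesDirection (e := (c, s)) hp,
      hf.onDirEdge_of_preservesDirection (e := (c, t)) hp] at h
    exact congrArg Prod.snd h
  · rw [hf.onDirEdge_of_not_preservesDirection (e := (c, s)) hp,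
      hf.onDirEdge_of_not_preservesDirection (e := (c, t)) hp] at h
    exact Bool.not_inj (congrArg Prod.snd h)

/-- The coordinate function of `g ∘ f` is the composite of those of `f` and `g`, so directions
multiply like signs. -/
lemma IsImmersion.preservesDirection_comp {g : D → B} {f : C → D} (hg : IsImmersion g)
    (hf : IsImmersion f) (e : Cell C 1) :
    PreservesDirection (g ∘ f) e (hg.onCell (hf.onCell e)) ↔
      (PreservesDirection f e (hf.onCell e) ↔
        PreservesDirection g (hf.onCell e) (hg.onCell (hf.onCell e))) := by
  change StrictMonoOn (edgeCoord _ _ _) _ ↔ (StrictMonoOn (edgeCoord _ _ _) _ ↔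
    StrictMonoOn (edgeCoord _ _ _) _)
  have hF := mapsTo_edgeCoord (hf.bijOn e)
  have hcomp : EqOn (edgeCoord g (hf.onCell e) (hg.onCell (hf.onCell e)) ∘
      edgeCoord f e (hf.onCell e)) (edgeCoord (g ∘ f) e (hg.onCell (hf.onCell e)))
      (Ioo (-1) 1) := fun t ht => by
    have hy := (hf.bijOn e).mapsTo
      (charMap_mem_openCell e (z := fun _ => t) (mem_ball_iff_Ioo.2 ht))
    simp only [Function.comp_apply, edgeCoord]
    rw [const_apply_zero, charMap_charMap_symm _ hy]
  rcases strictMonoOn_or_strictAntiOn_edgeCoord hf.continuous (hf.bijOn e) with h1 | h1 <;>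
  rcases strictMonoOn_or_strictAntiOn_edgeCoord hg.continuous (hg.bijOn (hf.onCell e)) with h2 | h2
  · simp [h1, h2, (h2.comp h1 hF).congr hcomp]
  · simp [h1, not_strictMonoOn_of_strictAntiOn h2,
      not_strictMonoOn_of_strictAntiOn ((h2.comp_strictMonoOn h1 hF).congr hcomp)]
  · simp [h2, not_strictMonoOn_of_strictAntiOn h1,
      not_strictMonoOn_of_strictAntiOn ((h2.comp_strictAntiOn h1 hF).congr hcomp)]
  · simp [not_strictMonoOn_of_strictAntiOn h1, not_strictMonoOn_of_strictAntiOn h2,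
      (h2.comp h1 hF).congr hcomp]

lemma IsImmersion.onDirEdge_comp {g : D → B} {f : C → D} (hg : IsImmersion g)
    (hf : IsImmersion f) (e : DirEdge C) :
    (hg.comp hf).onDirEdge e = hg.onDirEdge (hf.onDirEdge e) := by
  have hcell := onCell_comp hg hf e.1
  have hdir := preservesDirection_comp hg hf e.1
  rw [← hcell] at hdir
  by_cases h1 : PreservesDirection f e.1 (hf.onCell e.1)
  · rw [hf.onDirEdge_of_preservesDirection h1]
    by_cases h2 : PreservesDirection g (hf.onCell e.1) (hg.onCell (hf.onCell e.1))
    · rw [hg.onDirEdge_of_preservesDirection (e := (hf.onCell e.1, _)) h2,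
        (hg.comp hf).onDirEdge_of_preservesDirection (hdir.2 (by rw [hcell]; tauto)), hcell]
    · rw [hg.onDirEdge_of_not_preservesDirection (e := (hf.onCell e.1, _)) h2,
        (hg.comp hf).onDirEdge_of_not_preservesDirection
          (fun h => h2 (by have := hdir.1 h; rw [hcell] at this; tauto)), hcell]
  · rw [hf.onDirEdge_of_not_preservesDirection h1]
    by_cases h2 : PreservesDirection g (hf.onCell e.1) (hg.onCell (hf.onCell e.1))
    · rw [hg.onDirEdge_of_preservesDirection (e := (hf.onCell e.1, _)) h2,
        (hg.comp hf).onDirEdge_of_not_preservesDirection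
          (fun h => h1 (by have := hdir.1 h; rw [hcell] at this; tauto)), hcell]
    · rw [hg.onDirEdge_of_not_preservesDirection (e := (hf.onCell e.1, _)) h2,
        (hg.comp hf).onDirEdge_of_preservesDirection (hdir.2 (by rw [hcell]; tauto)), hcell]
      simp

/-- Edges starting at `v` with the same image have the corner `v` at the same place, so they share
the `1`-cell; their directions then agree too. -/
lemma IsImmersion.onDirEdge_injOn {f : C → D} (hf : IsImmersion f) (v : Cell C 0) :
    InjOn hf.onDirEdge {e | e.init = v} := by
  rintro ⟨c₁, s₁⟩ h₁ ⟨c₂, s₂⟩ h₂ h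
  have k₁ := hf.isCorner_init (c₁, s₁)
  have k₂ := hf.isCorner_init (c₂, s₂)
  rw [show DirEdge.init (c₁, s₁) = v from h₁] at k₁
  rw [show DirEdge.init (c₂, s₂) = v from h₂, ← h] at k₂
  have hcell : hf.onCell c₂ = hf.onCell c₁ := (congrArg Prod.fst h).symm
  obtain rfl : c₁ = c₂ := k₁.eq_of_same_image hf.isLocallyInjective (hf.bijOn c₁)
    (hcell ▸ hf.bijOn c₂) (sphere_subset_closedBall (startPoint_mem_sphere _)) k₂
  rw [hf.onDirEdge_injective_right h]

end Edges

/-! ### Continuity checked on closed cells -/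

section ContinuityOnCells

variable {C D : Type*} [TopologicalSpace C] [CWComplex (univ : Set C)] [TopologicalSpace D]
  {f : C → D}

lemma continuousOn_closedCell_of_extension [T2Space C] {n : ℕ} {c : Cell C n} {F : (Fin n → ℝ) → D}
    (hF : ContinuousOn F (closedBall 0 1)) (hFf : EqOn F (f ∘ charMap c) (ball 0 1))
    (hFs : EqOn F (f ∘ charMap c) (sphere 0 1)) :
    ContinuousOn f (RelCWComplex.closedCell n c) := by
  refine continuousOn_image_of_comp (isCompact_closedBall 0 1) (RelCWComplex.continuousOn n c)
    (hF.congr fun z hz => ?_)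
  rw [← ball_union_sphere] at hz
  exact (hz.elim (fun h => hFf h) fun h => hFs h).symm

lemma continuousOn_closedCell_zero (c : Cell C 0) :
    ContinuousOn f (RelCWComplex.closedCell 0 c) := by
  rw [RelCWComplex.closedCell_zero_eq_singleton]
  exact continuousOn_singleton _ _

/-- The frontier is covered by finitely many closed cells of lower dimension, each of them a closed
set. -/
lemma continuousOn_cellFrontier [T2Space C] {n : ℕ} (c : Cell C n)
    (h : ∀ m < n, ∀ d : Cell C m, ContinuousOn f (RelCWComplex.closedCell m d)) :
    ContinuousOn f (RelCWComplex.cellFrontier n c) := by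
  obtain ⟨I, hI⟩ := CWComplex.cellFrontier_subset_finite_closedCell n c
  have hcont : ContinuousOn f (⋃ p : Σ m : Fin n, I m, RelCWComplex.closedCell (p.1 : ℕ) p.2.1) :=
    (locallyFinite_of_finite _).continuousOn_iUnion
      (fun _ => RelCWComplex.isClosed_closedCell) fun p => h p.1 p.1.2 p.2.1
  refine hcont.mono (hI.trans ?_)
  simp only [iUnion_subset_iff]
  intro m hm j hj
  exact subset_iUnion_of_subset (⟨⟨m, hm⟩, ⟨j, hj⟩⟩ : Σ m : Fin n, I m) subset_rfl

lemma continuous_of_continuousOn_closedCell [T2Space C]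
    (h : ∀ n (c : Cell C n), ContinuousOn f (RelCWComplex.closedCell n c)) : Continuous f := by
  refine continuous_iff_isClosed.2 fun S hS => ?_
  refine (CWComplex.closed (univ : Set C) _ (subset_univ _)).2 fun n c => ?_
  rw [inter_comm]
  exact (h n c).preimage_isClosed_of_isClosed RelCWComplex.isClosed_closedCell hS

end ContinuityOnCells

/-! ### Maps defined cell by cell over `B` -/

section CellwiseLift

variable {C D B : Type*} [TopologicalSpace C] [CWComplex (univ : Set C)]
  [TopologicalSpace D] [CWComplex (univ : Set D)]
  {gC : C → B} {gD : D → B} {f : C → D} {δ : ∀ n, Cell C n → Cell D n}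

/-- `f` maps each open cell `c` to the open cell `δ c` and lifts `gC` through `gD`. -/
def IsCellwiseLift (gC : C → B) (gD : D → B) (δ : ∀ n, Cell C n → Cell D n) (f : C → D) : Prop :=
  ∀ n (c : Cell C n), ∀ y ∈ openCell c, f y ∈ openCell (δ n c) ∧ gD (f y) = gC y

namespace IsCellwiseLift

lemma comp_eq (hf : IsCellwiseLift gC gD δ f) : gD ∘ f = gC := funext fun y => by
  obtain ⟨n, c, hc⟩ := exists_mem_openCell y
  exact (hf n c y hc).2

lemma apply_point (hf : IsCellwiseLift gC gD δ f) (v : Cell C 0) : f (point v) = point (δ 0 v) :=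
  eq_point_of_mem (hf 0 v _ (mem_openCell_point v)).1

variable [TopologicalSpace B] [CWComplex (univ : Set B)]

/-- Both `gC` on `c` and `gD` on `δ n c` are bijections onto the same open cell of `B`, and `f` is
the first followed by the inverse of the second. -/
lemma bijOn (hf : IsCellwiseLift gC gD δ f) (hgC : IsImmersion gC)
    (hgD : IsImmersion gD) {n : ℕ} (c : Cell C n) :
    BijOn f (openCell c) (openCell (δ n c)) := by
  have hc := charMap_mem_openCell c (mem_ball_self one_pos)
  have hδ : hgD.onCell (δ n c) = hgC.onCell c := hgD.onCell_eq_of_mem (hf n c _ hc).1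
    ((hf n c _ hc).2 ▸ (hgC.bijOn c).mapsTo hc)
  refine ⟨fun y hy => (hf n c y hy).1, fun y hy y' hy' h => (hgC.bijOn c).injOn hy hy' ?_,
    fun z hz => ?_⟩
  · rw [← (hf n c y hy).2, h, (hf n c y' hy').2]
  · have hz' := (hgD.bijOn _).mapsTo hz
    rw [hδ] at hz'
    obtain ⟨y, hy, hyz⟩ := (hgC.bijOn c).surjOn hz'
    exact ⟨y, hy, (hgD.bijOn _).injOn (hf n c y hy).1 hz ((hf n c y hy).2.trans hyz)⟩

lemma isImmersion (hf : IsCellwiseLift gC gD δ f) (hgC : IsImmersion gC)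
    (hgD : IsImmersion gD) (hcont : Continuous f) :
    IsImmersion f where
  continuous := hcont
  exists_bijOn n c := ⟨δ n c, hf.bijOn hgC hgD c⟩
  exists_isEmbedding y := by
    obtain ⟨U, hU, h⟩ := hgC.exists_isEmbedding y
    rw [← hf.comp_eq] at h
    exact ⟨U, hU, IsEmbedding.of_comp (hcont.comp continuous_subtype_val) hgD.continuous h⟩

/-- A cellwise lift extends continuously from an open cell to the closed disc. -/
lemma exists_extension [T2Space D] [T2Space B]
    (hf : IsCellwiseLift gC gD δ f) (hgC : IsImmersion gC) (hgD : IsImmersion gD)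
    {n : ℕ} (c : Cell C n) : ∃ F : (Fin n → ℝ) → D, ContinuousOn F (closedBall 0 1) ∧
      EqOn F (f ∘ charMap c) (ball 0 1) ∧ EqOn (gD ∘ F) (gC ∘ charMap c) (closedBall 0 1) := by
  set d := δ n c
  set K := RelCWComplex.closedCell n d
  have : CompactSpace K := isCompact_iff_compactSpace.1 RelCWComplex.isCompact_closedCell
  have hball : ∀ z ∈ ball (0 : Fin n → ℝ) 1, f (charMap c z) ∈ openCell d := fun z hz =>
    (hf n c _ (charMap_mem_openCell c hz)).1
  have hsub : openCell d ⊆ K := RelCWComplex.openCell_subset_closedCell n d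
  classical
  -- The lift must take values in the compact closed cell; its value outside the open ball is
  -- arbitrary.
  set L : (Fin n → ℝ) → K := fun z =>
    if hz : z ∈ ball 0 1 then ⟨f (charMap c z), hsub (hball z hz)⟩
    else ⟨charMap d 0, RelCWComplex.map_zero_mem_closedCell n d⟩
  have hL : ∀ z ∈ ball (0 : Fin n → ℝ) 1, (L z : D) = f (charMap c z) := fun z hz => by
    simp only [L, dif_pos hz]
  have hg : Continuous fun y : K => gD y := hgD.continuous.comp continuous_subtype_val
  have hinj : IsLocallyInjective fun y : K => gD y :=
    hgD.isLocallyInjective.comp_right continuous_subtype_val Subtype.val_injective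
  have hh : ContinuousOn (gC ∘ charMap c) (closedBall 0 1) :=
    hgC.continuous.comp_continuousOn (RelCWComplex.continuousOn n c)
  have hLh : EqOn ((fun y : K => gD y) ∘ L) (gC ∘ charMap c) (ball 0 1) := fun z hz => by
    simp only [Function.comp_apply, hL z hz]
    exact (hf n c _ (charMap_mem_openCell c hz)).2
  -- Over a point of the open image cell the fibre in `K` is a single point, since a point of the
  -- closed cell lying over it is already in the open cell.
  have hLc : ContinuousOn L (ball 0 1) := fun z hz =>
    continuousWithinAt_lift hg ((hh z (ball_subset_closedBall hz)).mono ball_subset_closedBall) hLh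
      fun y hy => by
        have hLz : gD (L z) = gC (charMap c z) := hLh hz
        have hzd : (L z : D) ∈ openCell d := hL z hz ▸ hball z hz
        have hyz : gD y = gD (L z) := hy.trans hLz.symm
        have hyd : (y : D) ∈ openCell d :=
          hgD.mem_openCell y.2 (hyz ▸ (hgD.bijOn d).mapsTo hzd)
        exact Subtype.ext ((hgD.bijOn d).injOn hyd hzd hyz)
  have hcl : closure (ball (0 : Fin n → ℝ) 1) = closedBall 0 1 := closure_ball _ one_ne_zero
  obtain ⟨F, hF, hFL, hFh⟩ := exists_continuousOn_closure_lift hg hinj (convex_ball 0 1)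
    (by rwa [hcl]) hLc hLh
  rw [hcl] at hF hFh
  exact ⟨fun z => F z, continuous_subtype_val.comp_continuousOn hF,
    fun z hz => by simp only [hFL hz, hL z hz, Function.comp_apply], fun z hz => hFh hz⟩

/-- At a place where `c` and `δ c` have corresponding vertices, the extension has the right
value. -/
lemma extension_apply [T2Space C] [T2Space D] (hf : IsCellwiseLift gC gD δ f)
    {n : ℕ} {c : Cell C n} {b : Cell B n}
    {F : (Fin n → ℝ) → D} (hF : ContinuousOn F (closedBall 0 1))
    (hFf : EqOn F (f ∘ charMap c) (ball 0 1)) {x₀ : Fin n → ℝ} {v : Cell C 0}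
    (hv : IsCorner gC c b x₀ v) (hw : IsCorner gD (δ n c) b x₀ (δ 0 v))
    {l : Filter (Fin n → ℝ)} [l.NeBot] (hl : l ≤ 𝓝[ball 0 1] x₀) {z : (Fin n → ℝ) → (Fin n → ℝ)}
    (hz : ∀ x ∈ ball 0 1, z x ∈ ball 0 1 ∧ gC (charMap c (z x)) = charMap b x)
    {z₀ : Fin n → ℝ} (hz₀ : z₀ ∈ closedBall 0 1) (hlim : Tendsto z l (𝓝 z₀)) :
    charMap c z₀ = point v ∧ F z₀ = point (δ 0 v) := by
  have hmem : ∀ᶠ x in l, x ∈ ball (0 : Fin n → ℝ) 1 := hl self_mem_nhdsWithin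
  have hlim' : Tendsto z l (𝓝[closedBall 0 1] z₀) := tendsto_nhdsWithin_iff.2
    ⟨hlim, hmem.mono fun x hx => ball_subset_closedBall (hz x hx).1⟩
  -- Along `l`, the points `charMap c (z x)` tend to `v` and their images under `f` tend to `δ 0 v`;
  -- continuity at `z₀` gives the same limits as `charMap c z₀` and `F z₀`.
  have h1 := hv.tendsto (tendsto_id'.2 hl)
    (hmem.mono fun x hx => charMap_mem_openCell c (hz x hx).1) (hmem.mono fun x hx => (hz x hx).2)
  have h2 := hw.tendsto (tendsto_id'.2 hl) (y := fun x => f (charMap c (z x)))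
    (hmem.mono fun x hx => (hf n c _ (charMap_mem_openCell c (hz x hx).1)).1)
    (hmem.mono fun x hx => ((hf n c _ (charMap_mem_openCell c (hz x hx).1)).2).trans (hz x hx).2)
  refine ⟨tendsto_nhds_unique ((RelCWComplex.continuousOn n c z₀ hz₀).tendsto.comp hlim') h1,
    tendsto_nhds_unique ((hF z₀ hz₀).tendsto.comp hlim') (h2.congr' ?_)⟩
  exact hmem.mono fun x hx => (hFf (hz x hx).1).symm

/-- The two directions of `c` start at its two ends, so the hypothesis fixes the extension at both
boundary points. -/
lemma continuousOn_closedCell_one [T2Space C] [T2Space D] [T2Space B]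
    (hf : IsCellwiseLift gC gD δ f) (hgC : IsImmersion gC)
    (hgD : IsImmersion gD) (c : Cell C 1)
    (h : ∀ e : DirEdge C, e.1 = c → ∃ ε : DirEdge D, ε.1 = δ 1 e.1 ∧
      hgD.onDirEdge ε = hgC.onDirEdge e ∧ ε.init = δ 0 e.init) :
    ContinuousOn f (RelCWComplex.closedCell 1 c) := by
  obtain ⟨F, hF, hFf, -⟩ := hf.exists_extension hgC hgD c
  refine continuousOn_closedCell_of_extension hF hFf fun z₀ hz₀ => ?_
  obtain ⟨s, rfl⟩ := exists_startPoint_eq hz₀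
  obtain ⟨ε, hε, hεe, hinit⟩ := h (c, s) rfl
  have hw := hgD.isCorner_init ε
  rw [hε, hinit, hεe] at hw
  obtain ⟨z, hz⟩ := exists_lift_coord (hgC.bijOn c)
  have := ball_neBot (sphere_subset_closedBall (startPoint_mem_sphere (hgC.onDirEdge (c, s)).2))
  obtain ⟨h1, h2⟩ := hf.extension_apply hF hFf (hgC.isCorner_init (c, s)) hw le_rfl hz
    (sphere_subset_closedBall hz₀) (hgC.tendsto_coord_start (c, s) hz)
  rw [h2, Function.comp_apply, h1, hf.apply_point]

lemma continuousOn_closedCell_two [T2Space C] [T2Space D] [T2Space B]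
    (hf : IsCellwiseLift gC gD δ f) (hgC : IsImmersion gC)
    (hgD : IsImmersion gD) (c : Cell C 2)
    (hfr : ContinuousOn f (RelCWComplex.cellFrontier 2 c)) {x₀ : Fin 2 → ℝ}
    (hx₀ : x₀ ∈ closedBall 0 1) {v : Cell C 0} (hv : IsCorner gC c (hgC.onCell c) x₀ v)
    (hw : IsCorner gD (δ 2 c) (hgC.onCell c) x₀ (δ 0 v)) :
    ContinuousOn f (RelCWComplex.closedCell 2 c) := by
  obtain ⟨F, hF, hFf, hFg⟩ := hf.exists_extension hgC hgD c
  refine continuousOn_closedCell_of_extension hF hFf ?_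
  obtain ⟨z, hz⟩ := exists_lift_coord (hgC.bijOn c)
  have := ball_neBot hx₀
  -- Convergence of the coordinate `z x` as `x → x₀` is not established; compactness of the disc
  -- supplies a limit `z₀` along an ultrafilter, and one such point is enough.
  set l : Ultrafilter (Fin 2 → ℝ) := Ultrafilter.of (𝓝[ball 0 1] x₀)
  have hl : (l : Filter (Fin 2 → ℝ)) ≤ 𝓝[ball 0 1] x₀ := Ultrafilter.of_le _
  obtain ⟨z₀, hz₀, hlim⟩ := (isCompact_closedBall (0 : Fin 2 → ℝ) 1).ultrafilter_le_nhds (l.map z)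
    (le_principal_iff.2 (mem_map.2 (mem_of_superset (hl self_mem_nhdsWithin) fun x hx =>
      ball_subset_closedBall (hz x hx).1)))
  obtain ⟨h1, h2⟩ := hf.extension_apply hF hFf hv hw hl hz hz₀ hlim
  -- The characteristic map sends `z₀` to a vertex, which cannot lie in the open `2`-cell.
  have hz₀s : z₀ ∈ sphere (0 : Fin 2 → ℝ) 1 := by
    rw [← ball_union_sphere] at hz₀
    refine hz₀.resolve_left fun hb => ?_
    have := cell_eq_of_mem (charMap_mem_openCell c hb) (h1 ▸ mem_openCell_point v)
    exact absurd (congrArg Sigma.fst this) (by norm_num)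
  have hconn : IsPreconnected (sphere (0 : Fin 2 → ℝ) 1) :=
    isPreconnected_sphere (by simp) 0 1
  -- Uniqueness of lifts on the connected circle: both maps lift `gC ∘ charMap c` and agree at `z₀`.
  refine (T2Space.isSeparatedMap gD).eqOn_of_comp_eqOn hgD.isLocallyInjective hconn
    (hF.mono sphere_subset_closedBall) ?_ (fun x hx => ?_) hz₀s ?_
  · exact hfr.comp ((RelCWComplex.continuousOn 2 c).mono sphere_subset_closedBall)
      (mapsTo_image _ _)
  · rw [hFg (sphere_subset_closedBall hx), ← hf.comp_eq]
    rfl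
  · rw [h2, Function.comp_apply, h1, hf.apply_point]

end IsCellwiseLift

variable [TopologicalSpace B] [CWComplex (univ : Set B)]

/-- Every point lies in exactly one open cell `c`, and `gD` carries `δ n c` onto the open cell
containing its image under `gC`. -/
lemma exists_isCellwiseLift (hgC : IsImmersion gC) (hgD : IsImmersion gD)
    (hδ : ∀ n (c : Cell C n), hgD.onCell (δ n c) = hgC.onCell c) :
    ∃ f : C → D, IsCellwiseLift gC gD δ f := by
  have h : ∀ y : C, ∃ z : D, ∀ n (c : Cell C n), y ∈ openCell c →
      z ∈ openCell (δ n c) ∧ gD z = gC y := fun y => by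
    obtain ⟨n, c, hc⟩ := exists_mem_openCell y
    have hy := (hgC.bijOn c).mapsTo hc
    rw [← hδ] at hy
    obtain ⟨z, hz, hzy⟩ := (hgD.bijOn (δ n c)).surjOn hy
    refine ⟨z, fun m d hd => ?_⟩
    obtain ⟨rfl, h⟩ := Sigma.mk.inj (cell_eq_of_mem hc hd)
    obtain rfl := eq_of_heq h
    exact ⟨hz, hzy⟩
  choose f hf using h
  exact ⟨f, fun n c y hy => hf y n c hy⟩

/-- A map of the cells which is compatible with the immersions `gC` and `gD`, with the ends of edges
and with one vertex of each `2`-cell is induced by an immersion. -/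
lemma exists_isImmersion_comp_eq [IsTwoComplex C] [T2Space D] [T2Space B] (hgC : IsImmersion gC)
    (hgD : IsImmersion gD) (hδ : ∀ n (c : Cell C n), hgD.onCell (δ n c) = hgC.onCell c)
    (h1 : ∀ e : DirEdge C, ∃ ε : DirEdge D, ε.1 = δ 1 e.1 ∧
      hgD.onDirEdge ε = hgC.onDirEdge e ∧ ε.init = δ 0 e.init)
    (h2 : ∀ c : Cell C 2, ∃ x₀ ∈ closedBall (0 : Fin 2 → ℝ) 1, ∃ v,
      IsCorner gC c (hgC.onCell c) x₀ v ∧ IsCorner gD (δ 2 c) (hgC.onCell c) x₀ (δ 0 v)) :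
    ∃ f : C → D, IsImmersion f ∧ gD ∘ f = gC := by
  obtain ⟨f, hf⟩ := exists_isCellwiseLift hgC hgD hδ
  have c0 := continuousOn_closedCell_zero (C := C) (f := f)
  have c1 := fun c => hf.continuousOn_closedCell_one hgC hgD c fun e _ => h1 e
  have c2 : ∀ c : Cell C 2, ContinuousOn f (RelCWComplex.closedCell 2 c) := fun c => by
    obtain ⟨x₀, hx₀, v, hv, hw⟩ := h2 c
    refine hf.continuousOn_closedCell_two hgC hgD c (continuousOn_cellFrontier c fun m hm d => ?_)
      hx₀ hv hw
    interval_cases m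
    · exact c0 d
    · exact c1 d
  refine ⟨f, hf.isImmersion hgC hgD (continuous_of_continuousOn_closedCell fun n c => ?_),
    hf.comp_eq⟩
  match n, c with
  | 0, c => exact c0 c
  | 1, c => exact c1 c
  | 2, c => exact c2 c
  | n + 3, c => exact ((IsTwoComplex.dim_le_two (C := C) (n + 3) (by omega)).false c).elim

end CellwiseLift

/-! ### Passing between complexes and labeled graphs -/

section Graphs

variable {X P C D B : Type*} [TopologicalSpace C] [CWComplex (univ : Set C)]
  [TopologicalSpace D] [CWComplex (univ : Set D)]
  [TopologicalSpace B] [CWComplex (univ : Set B)] [IsTwoComplex B]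
  (𝓑 : LabelComplex X P B) {gC : C → B} (hgC : IsImmersion gC) {gD : D → B} (hgD : IsImmersion gD)

lemma basePoint_mem_closedBall (ρ : P) : 𝓑.basePoint ρ ∈ closedBall (0 : Fin 2 → ℝ) 1 :=
  sphere_subset_closedBall (𝓑.basePoint_mem ρ)

lemma onCell_eq_of_faceLabel_eq {c : Cell C 2} {d : Cell D 2}
    (h : faceLabel 𝓑 hgD d = faceLabel 𝓑 hgC c) : hgD.onCell d = hgC.onCell c :=
  𝓑.face.symm.injective h

lemma onDirEdge_eq_of_edgeLabel_eq {e : DirEdge C} {ε : DirEdge D}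
    (h : edgeLabel 𝓑 hgD ε = edgeLabel 𝓑 hgC e) : hgD.onDirEdge ε = hgC.onDirEdge e :=
  have h2 : (edgeLabel 𝓑 hgD ε).2 = (edgeLabel 𝓑 hgC e).2 := congrArg Prod.snd h
  Prod.ext (𝓑.edge.symm.injective (congrArg Prod.fst h)) h2

variable [IsTwoComplex C]

lemma isCorner_root (c : Cell C 2) :
    IsCorner gC c (hgC.onCell c) (𝓑.basePoint (faceLabel 𝓑 hgC c)) (root 𝓑 hgC c) :=
  (exists_root 𝓑 hgC c).choose_spec

variable {𝓑 hgC hgD}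

/-- Equal images force equal labels, hence equal images under `gC`. The common root is then a common
corner with respect to `gC`, whose local injectivity identifies the cells. -/
lemma RespectsLabeling.onCell_injOn {f : C → D} {hf : IsImmersion f}
    (h : RespectsLabeling 𝓑 hgC hgD hf) (v : Cell C 0) :
    InjOn (hf.onCell (n := 2)) {c | root 𝓑 hgC c = v} := by
  intro c₁ h₁ c₂ h₂ h12
  have hlabel : faceLabel 𝓑 hgC c₂ = faceLabel 𝓑 hgC c₁ := by
    rw [← h.faceLabel_eq, ← h.faceLabel_eq, h12]
  have hcell := onCell_eq_of_faceLabel_eq 𝓑 hgC hgC hlabel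
  have k₁ := isCorner_root 𝓑 hgC c₁
  have k₂ := isCorner_root 𝓑 hgC c₂
  rw [show root 𝓑 hgC c₁ = v from h₁] at k₁
  rw [show root 𝓑 hgC c₂ = v from h₂, hlabel, hcell] at k₂
  exact k₁.eq_of_same_image hgC.isLocallyInjective (hgC.bijOn c₁) (hcell ▸ hgC.bijOn c₂)
    (basePoint_mem_closedBall 𝓑 _) k₂

lemma respectsLabeling_of_comp_eq {f : C → D} (hf : IsImmersion f) (h : gD ∘ f = gC) :
    RespectsLabeling 𝓑 hgC hgD hf := by
  subst h
  refine ⟨fun e => ?_, fun c => ?_, fun c => rfl⟩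
  · rw [edgeLabel, edgeLabel, ← hgD.onDirEdge_comp hf]
  · rw [faceLabel, faceLabel, ← hgD.onCell_comp hf]

variable [IsTwoComplex D]

lemma RespectsLabeling.root_onCell {f : C → D} {hf : IsImmersion f}
    (h : RespectsLabeling 𝓑 hgC hgD hf) (c : Cell C 2) :
    root 𝓑 hgD (hf.onCell c) = hf.onCell (root 𝓑 hgC c) := by
  have h1 := isCorner_root 𝓑 (hgD.comp hf) c
  have hlabel : faceLabel 𝓑 (hgD.comp hf) c = faceLabel 𝓑 hgD (hf.onCell c) :=
    congrArg 𝓑.face.symm (hgD.onCell_comp hf c)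
  -- Agreement of the two labelings of `C` on roots makes the root for `gC` a corner with respect to
  -- `gD ∘ f`, which `f` can push forward to `D`.
  rw [h.root_eq, hgD.onCell_comp hf, hlabel] at h1
  exact IsRoot.unique (hgD.bijOn _) (𝓑.basePoint_mem _) (isCorner_root 𝓑 hgD (hf.onCell c))
    (h1.push hf.continuous (hf.bijOn c) (hf.apply_point _))

/-- The immersion of labeled graphs induced by a label-respecting immersion of `2`-complexes. -/
noncomputable def RespectsLabeling.graphImmersion {f : C → D} {hf : IsImmersion f}
    (h : RespectsLabeling 𝓑 hgC hgD hf) :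
    GraphImmersion (graphOf 𝓑 hgC) (graphOf 𝓑 hgD) where
  onV := hf.onCell (n := 0)
  onE := Sum.map hf.onDirEdge (hf.onCell (n := 2))
  init_onE := by
    rintro (e | c)
    · exact hf.init_onDirEdge e
    · exact h.root_onCell c
  ter_onE := by
    rintro (e | c)
    · exact (congrArg DirEdge.init (hf.onDirEdge_rev e).symm).trans (hf.init_onDirEdge e.rev)
    · exact h.root_onCell c
  inv_onE := by
    rintro (e | c)
    · exact congrArg Sum.inl (hf.onDirEdge_rev e)
    · rfl
  label_onE := by
    rintro (e | c)
    · exact congrArg (fun p : X × Bool => Letter.edge p.1 p.2) (h.edgeLabel_eq e)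
    · exact congrArg Letter.face (h.faceLabel_eq c)
  injOn_star v := by
    rintro (e₁ | c₁) h₁ (e₂ | c₂) h₂ h12
    · exact congrArg Sum.inl (hf.onDirEdge_injOn v h₁ h₂ (Sum.inl_injective h12))
    · exact (Sum.inl_ne_inr h12).elim
    · exact (Sum.inr_ne_inl h12).elim
    · exact congrArg Sum.inr (h.onCell_injOn v h₁ h₂ (Sum.inr_injective h12))

/-- Letters from `X ∪ X⁻¹` and from `P` are distinct, so a label-preserving map cannot send a
directed edge to a loop of a `2`-cell. -/
lemma GraphImmersion.exists_onE_inl (φ : GraphImmersion (graphOf 𝓑 hgC) (graphOf 𝓑 hgD))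
    (e : DirEdge C) : ∃ ε : DirEdge D, φ.onE (Sum.inl e) = Sum.inl ε ∧
      edgeLabel 𝓑 hgD ε = edgeLabel 𝓑 hgC e ∧ ε.init = φ.onV e.init := by
  have hlabel := φ.label_onE (Sum.inl e)
  have hinit := φ.init_onE (Sum.inl e)
  rcases hE : φ.onE (Sum.inl e) with ε | d
  · rw [hE] at hlabel hinit
    obtain ⟨h1, h2⟩ := Letter.edge.inj hlabel
    exact ⟨ε, rfl, Prod.ext h1 h2, hinit⟩
  · rw [hE] at hlabel
    cases hlabel

lemma GraphImmersion.exists_onE_inr (φ : GraphImmersion (graphOf 𝓑 hgC) (graphOf 𝓑 hgD))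
    (c : Cell C 2) : ∃ d : Cell D 2,
      faceLabel 𝓑 hgD d = faceLabel 𝓑 hgC c ∧ root 𝓑 hgD d = φ.onV (root 𝓑 hgC c) := by
  have hlabel := φ.label_onE (Sum.inr c)
  have hinit := φ.init_onE (Sum.inr c)
  rcases hE : φ.onE (Sum.inr c) with ε | d
  · rw [hE] at hlabel
    cases hlabel
  · rw [hE] at hlabel hinit
    exact ⟨d, Letter.face.inj hlabel, hinit⟩

/-- An immersion of the labeled graphs is induced by an immersion over `B`. -/
lemma GraphImmersion.exists_isImmersion_comp_eq
    (φ : GraphImmersion (graphOf 𝓑 hgC) (graphOf 𝓑 hgD)) :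
    ∃ f : C → D, IsImmersion f ∧ gD ∘ f = gC := by
  choose ε hε hεlabel hεinit using φ.exists_onE_inl
  choose d hdlabel hdroot using φ.exists_onE_inr
  have hrev : ∀ e : DirEdge C, ε e.rev = (ε e).rev := fun e => by
    have h := φ.inv_onE (Sum.inl e)
    rw [hε e] at h
    exact Sum.inl_injective ((hε e.rev).symm.trans h)
  -- Compatibility with inversion makes the image `1`-cell independent of the direction, so `δ 1` is
  -- well defined.
  have hfst : ∀ e : DirEdge C, (ε e).1 = (ε (e.1, true)).1 := by
    rintro ⟨c, _ | _⟩
    · exact (congrArg Prod.fst (hrev (c, true)) :)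
    · rfl
  set δ : ∀ n, Cell C n → Cell D n := fun n => match n with
    | 0 => φ.onV
    | 1 => fun c => (ε (c, true)).1
    | 2 => d
    | n + 3 => fun c => ((IsTwoComplex.dim_le_two (C := C) (n + 3) (by omega)).false c).elim
  refine TwoComplexes.exists_isImmersion_comp_eq hgC hgD (δ := δ) (fun n c => ?_)
    (fun e => ⟨ε e, hfst e, onDirEdge_eq_of_edgeLabel_eq 𝓑 hgC hgD (hεlabel e), hεinit e⟩)
    fun c => ⟨_, basePoint_mem_closedBall 𝓑 _, _, isCorner_root 𝓑 hgC c, ?_⟩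
  · match n, c with
    -- On vertices the compatibility over `B` is automatic, as `B` has only one `0`-cell.
    | 0, c => rw [𝓑.vertex_unique (hgD.onCell _), 𝓑.vertex_unique (hgC.onCell _)]
    | 1, c =>
      exact congrArg Prod.fst (onDirEdge_eq_of_edgeLabel_eq 𝓑 hgC hgD (hεlabel (c, true)))
    | 2, c => exact onCell_eq_of_faceLabel_eq 𝓑 hgC hgD (hdlabel c)
    | n + 3, c => exact ((IsTwoComplex.dim_le_two (C := C) (n + 3) (by omega)).false c).elim
  · have h := isCorner_root 𝓑 hgD (d c)
    rw [onCell_eq_of_faceLabel_eq 𝓑 hgC hgD (hdlabel c), hdlabel, hdroot] at h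
    exact h

end Graphs

end TwoComplexes

open TwoComplexes in
theorem mainTheorem9 {X P C D B : Type*}
    [TopologicalSpace C] [CWComplex (univ : Set C)] [IsTwoComplex C]
    [TopologicalSpace D] [CWComplex (univ : Set D)] [IsTwoComplex D]
    [TopologicalSpace B] [CWComplex (univ : Set B)] [IsTwoComplex B]
    (𝓑 : LabelComplex X P B)
    {gC : C → B} (hgC : IsImmersion gC) {gD : D → B} (hgD : IsImmersion gD) :
    (∃ (f : C → D) (hf : IsImmersion f), RespectsLabeling 𝓑 hgC hgD hf) ↔
      Nonempty (GraphImmersion (graphOf 𝓑 hgC) (graphOf 𝓑 hgD)) := by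
  constructor
  · rintro ⟨f, hf, h⟩
    exact ⟨h.graphImmersion⟩
  · rintro ⟨φ⟩
    obtain ⟨f, hf, h⟩ := φ.exists_isImmersion_comp_eq
    exact ⟨f, hf, respectsLabeling_of_comp_eq hf h⟩
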